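/- **Market.** There are $N$ locations $\mathcal N=\{1,\dots,N\}$; links are the pairs $(i,j)$ with $i\neq j$. If on day $d=1,2,\dots$ the price on link $(i,j)$ is $p_{ij}^d$, the demand on it is $\Psi^d_{ij}=\alpha_{ij}-\beta_{ij}p^d_{ij}+\epsilon^d_{ij}$, where $\theta_{ij}=(\alpha_{ij},\beta_{ij})\in[\alpha_{\min},\alpha_{\max}]\times[\beta_{\min},\beta_{\max}]$ is unknown to the provider and $\alpha_{\min},\beta_{\min}>0$. The shock vectors $\epsilon^1,\epsilon^2,\dots$ are independent, and for each link $(i,j)$ the shocks $\epsilon^d_{ij}$ have a common known distribution $F_{ij}$ on $[\underline\epsilon,\overline\epsilon]$ with mean $0$. With a price cap $p_{\max}$, a unit cost $c$ and travel times $\xi_{ij}>0$, assume $0<c<p_{\max}$ and $\alpha_{\min}-\beta_{\max}p_{\max}+\underline\epsilon\ge 0$. A decision $(p,w)$ consists of prices and supplies; it is feasible if $p_{ij}\le p_{\max}$, $w_{ij}\ge0$ and $\sum_{j\ne i}w_{ij}=\sum_{j\neq i}w_{ji}$ for all $i$. The payoff on a day with shocks $\epsilon$ is $$\Pi(p,w,\epsilon)=\sum_{i}\sum_{j\ne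 i}\xi_{ij}\min\{\alpha_{ij}-\beta_{ij}p_{ij}+\epsilon_{ij},\,w_{ij}\}\,p_{ij}-\sum_i\sum_{j\neq i}\xi_{ij}w_{ij}c .$$ For parameters $\vartheta=(a_{ij},b_{ij})$ let $(p^*(\vartheta),w^*(\vartheta))$ be the optimal solution of the problem of maximizing the expected value of this payoff, with $(\alpha,\beta)$ replaced by $(a,b)$, over all feasible $(p,w)$ with $w_{ij}=a_{ij}-b_{ij}p_{ij}$ for all links. The clairvoyant policy uses $(p^*(\theta),w^*(\theta))$ on every day. **NRPS policy.** Fix $\rho\in(0,\infty)$ and $\eta\in(0,1/2)$. The initial estimate $\hat\theta^0$, with $\hat\theta_{ij}^0\in[\alpha_{\min},\alpha_{\max}]\times[\beta_{\min},\beta_{\max}]$, is drawn from an arbitrary distribution, independently of the shocks. On an odd day $d\geq 3$, for each link let $\tilde\theta_{ij}^{d-1}$ minimize $\sum_{\tau=1}^{d-1}\big(\Psi_{ij}^\tau-(a-b\,p_{ij}^\tau)\big)^2$ over $(a,b)\in\mathbb R^2$, and let $\hat\theta_{ij}^{d-1}=(\hat\alpha_{ij}^{d-1},\hat\beta_{ij}^{d-1})$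 be its projection onto $[\alpha_{\min},\alpha_{\max}]\times[\beta_{\min},\beta_{\max}]$. On every odd day $d$ the provider implements $p^*(\hat\theta^{d-1}),\,w^*(\hat\theta^{d-1})$. On every even day $d$ it implements $p_{ij}^*(\hat\theta^{d-2})-\frac{\rho}{\hat\beta_{ij}^{d-2}}d^{-\eta}$ and $w_{ij}^*(\hat\theta^{d-2})+\rho d^{-\eta}$ on each link. **Claim.** The NRPS policy is a no-regret policy: its decisions $(p^d,w^d)$ are always feasible, the expectation $$\Delta_D=\mathbb E\Big\{\frac1D\sum_{d=1}^D\big(\Pi(p^*(\theta),w^*(\theta),\epsilon^d)-\Pi(p^d,w^d,\epsilon^d)\big)\Big\},$$ over the shocks and $\hat\theta^0$, exists for every $D$, and $\lim_{D\to\infty}\Delta_D=0$. -/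

import Mathlib

open MeasureTheory ProbabilityTheory Filter Topology

noncomputable section

namespace VehicleService

/-- The links `(i, j)`, `i ≠ j`, between the `N` locations; `e.1.1` is the origin of the link `e`
and `e.1.2` its destination. -/
abbrev Link (N : ℕ) : Type := {e : Fin N × Fin N // e.1 ≠ e.2}

/-- Demand model parameters: `(θ e).1` is `α` and `(θ e).2` is `β` on the link `e`. -/
abbrev Params (N : ℕ) : Type := Link N → ℝ × ℝ

/-- The provider's decisions on one day: a price and a supply for every link. -/
structure Decision (N : ℕ) where
  price : Link N → ℝ
  supply : Link N → ℝ

instance (N : ℕ) : Nonempty (Decision N) := ⟨⟨0, 0⟩⟩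

/-- What the provider has seen at the end of one day: its decisions and the realized demand. -/
structure Record (N : ℕ) extends Decision N where
  demand : Link N → ℝ

/-- Everything about the market that the provider knows from the beginning, with the standing
assumptions of the model. The true demand parameters are not part of it. -/
structure Market (N : ℕ) where
  /-- known bounds on the demand parameters -/
  αmin : ℝ
  αmax : ℝ
  βmin : ℝ
  βmax : ℝ
  /-- bounds on the demand shocks -/
  εlo : ℝ
  εhi : ℝ
  /-- the maximum price -/
  pmax : ℝ
  /-- the cost of supplying one vehicle per time slot -/
  c : ℝ
  /-- travel times -/
  ξ : Link N → ℝ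
  /-- the law of the demand shock on each link -/
  F : Link N → Measure ℝ
  αmin_pos : 0 < αmin
  βmin_pos : 0 < βmin
  c_pos : 0 < c
  c_lt_pmax : c < pmax
  ξ_pos : ∀ e, 0 < ξ e
  demand_nonneg : 0 ≤ αmin - βmax * pmax + εlo
  F_prob : ∀ e, IsProbabilityMeasure (F e)
  F_supp : ∀ e, ∀ᵐ x ∂(F e), x ∈ Set.Icc εlo εhi
  F_mean : ∀ e, ∫ x, x ∂(F e) = 0

/-- Users' demand `α - β p + x` on the link `e` at price `p` and shock `x`. -/
def demand {N : ℕ} (θ : Params N) (e : Link N) (p x : ℝ) : ℝ :=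
  (θ e).1 - (θ e).2 * p + x

/-- Vehicle flow balance: at every location the departure rate equals the arrival rate. -/
def FlowBalance {N : ℕ} (w : Link N → ℝ) : Prop :=
  ∀ i : Fin N, ∑ e : Link N with e.1.1 = i, w e = ∑ e : Link N with e.1.2 = i, w e

namespace Market

variable {N : ℕ} (M : Market N)

/-- The rectangle `[αmin, αmax] × [βmin, βmax]`. -/
def paramSet : Set (ℝ × ℝ) := Set.Icc M.αmin M.αmax ×ˢ Set.Icc M.βmin M.βmax

/-- The constraints that every decision has to satisfy. -/
def Feasible (x : Decision N) : Prop :=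
  (∀ e, x.price e ≤ M.pmax) ∧ (∀ e, 0 ≤ x.supply e) ∧ FlowBalance x.supply

/-- The provider's payoff per time slot under the decision `x` and the shocks `s`. -/
def payoff (θ : Params N) (x : Decision N) (s : Link N → ℝ) : ℝ :=
  (∑ e, M.ξ e * min (demand θ e (x.price e) (s e)) (x.supply e) * x.price e)
    - ∑ e, M.ξ e * x.supply e * M.c

/-! ### The provider's problem for estimated parameters -/

/-- The objective for the parameters `θ`; the expectation is taken with the known shock laws. -/
def objective (θ : Params N) (x : Decision N) : ℝ :=
  (∑ e, M.ξ e * (∫ s, min (demand θ e (x.price e) s) (x.supply e) ∂(M.F e)) * x.price e)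
    - ∑ e, M.ξ e * x.supply e * M.c

/-- Feasibility together with the local supply-demand balance for the parameters `θ`. -/
def Balanced (θ : Params N) (x : Decision N) : Prop :=
  M.Feasible x ∧ ∀ e, x.supply e = (θ e).1 - (θ e).2 * x.price e

/-- `x` is an optimal solution of the provider's problem for the parameters `θ`. -/
def IsOptimal (θ : Params N) (x : Decision N) : Prop :=
  M.Balanced θ x ∧ ∀ y, M.Balanced θ y → M.objective θ y ≤ M.objective θ x

/-- The optimal solution `(p*(θ), w*(θ))`. -/
def optSol (θ : Params N) : Decision N := Classical.epsilon (M.IsOptimal θ)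

/-! ### Least squares estimation -/

/-- The sum of squared residuals of `(a, b)` on the link `e` over the days in the history `h`. -/
def sqLoss (h : List (Record N)) (e : Link N) (t : ℝ × ℝ) : ℝ :=
  (h.map fun r => (r.demand e - (t.1 - t.2 * r.price e)) ^ 2).sum

/-- A minimizer over `ℝ²` of the sum of squared residuals. -/
def leastSquares (h : List (Record N)) (e : Link N) : ℝ × ℝ :=
  Classical.epsilon fun t => ∀ t', sqLoss h e t ≤ sqLoss h e t'

/-- The projection of `ℝ²` onto the rectangle of parameters. -/
def project (t : ℝ × ℝ) : ℝ × ℝ :=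
  (max (min t.1 M.αmax) M.αmin, max (min t.2 M.βmax) M.βmin)

/-- The estimate given the history `h`; without any history it is the initial pick `θ₀`. -/
def estimate (θ₀ : Params N) (h : List (Record N)) : Params N :=
  if h = [] then θ₀ else fun e => M.project (leastSquares h e)

end Market

/-! ### Policies -/

/-- A (possibly randomized) policy. It maps its private random seed, of type `S`, and the history
of the days `1, …, d - 1`, in chronological order, to the decision on day `d`; so `d` is one more
than the length of the history. -/
abbrev Policy (N : ℕ) (S : Type*) : Type _ := S → List (Record N) → Decision N

/-- The history of the first `n` days if the policy `π` is run with the seed `s`, the true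
parameters are `θ`, and `x m` is the vector of demand shocks on day `m + 1`. -/
def history {N : ℕ} {S : Type*} (θ : Params N) (π : Policy N S) (s : S) (x : ℕ → Link N → ℝ) :
    ℕ → List (Record N)
  | 0 => []
  | n + 1 =>
    let h := history θ π s x n
    let a := π s h
    h ++ [{ toDecision := a, demand := fun e => demand θ e (a.price e) (x n e) }]

/-- The decision that the policy implements on day `n + 1`. -/
def decision {N : ℕ} {S : Type*} (θ : Params N) (π : Policy N S) (s : S) (x : ℕ → Link N → ℝ)
    (n : ℕ) : Decision N :=
  π s (history θ π s x n)

namespace Market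

variable {N : ℕ} (M : Market N)

/-- The NRPS policy with control parameters `ρ` and `η`; its seed is the initial estimate `θ₀`.
On an even day `d`, the decision modifies the solution of the previous day `d - 1`, which was based
on the history of the first `d - 2` days. -/
def nrps (ρ η : ℝ) : Policy N (Params N) := fun θ₀ h =>
  let d : ℕ := h.length + 1
  if Odd d then M.optSol (M.estimate θ₀ h)
  else
    let θ' := M.estimate θ₀ h.dropLast
    { price := fun e => (M.optSol θ').price e - ρ / (θ' e).2 * (d : ℝ) ^ (-η)
      supply := fun e => (M.optSol θ').supply e + ρ * (d : ℝ) ^ (-η) }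

/-! ### Clairvoyant policy and regret

`P` is the underlying probability measure, and `ε n ω` is the vector of shocks on day `n + 1`. -/

variable {Ω : Type*} [MeasurableSpace Ω] (P : Measure Ω) (ε : ℕ → Ω → Link N → ℝ)

/-- The constraints of the clairvoyant problem on day `n + 1`. -/
def ClairvoyantFeasible (θ : Params N) (n : ℕ) (x : Decision N) : Prop :=
  M.Feasible x ∧ ∀ e, x.supply e = ∫ ω, demand θ e (x.price e) (ε n ω e) ∂P

/-- `x` maximizes the expected payoff on day `n + 1` under the constraints of the clairvoyant
problem. -/
def IsClairvoyant (θ : Params N) (n : ℕ) (x : Decision N) : Prop :=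
  M.ClairvoyantFeasible P ε θ n x ∧ ∀ y, M.ClairvoyantFeasible P ε θ n y →
    ∫ ω, M.payoff θ y (ε n ω) ∂P ≤ ∫ ω, M.payoff θ x (ε n ω) ∂P

/-- The decision of the clairvoyant policy on day `n + 1`. -/
def clairvoyant (θ : Params N) (n : ℕ) : Decision N :=
  Classical.epsilon (M.IsClairvoyant P ε θ n)

/-- The average over the first `D` days of the realized payoff of the clairvoyant policy minus the
realized payoff of the policy `π` with the random seed `seed`. -/
def avgGap {S : Type*} (θ : Params N) (π : Policy N S) (seed : Ω → S) (D : ℕ) (ω : Ω) : ℝ :=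
  (1 / (D : ℝ)) * ∑ n ∈ Finset.range D,
    (M.payoff θ (M.clairvoyant P ε θ n) (ε n ω)
      - M.payoff θ (decision θ π (seed ω) (fun m => ε m ω) n) (ε n ω))

/-- The time-average regret during the first `D` days. -/
def regret {S : Type*} (θ : Params N) (π : Policy N S) (seed : Ω → S) (D : ℕ) : ℝ :=
  ∫ ω, M.avgGap P ε θ π seed D ω ∂P

/-- `π` is a no-regret policy: its decisions are always feasible, the expectations that define the
time-average regret exist, and the time-average regret tends to zero. -/
def IsNoRegret {S : Type*} (θ : Params N) (π : Policy N S) (seed : Ω → S) : Prop :=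
  (∀ ω n, M.Feasible (decision θ π (seed ω) (fun m => ε m ω) n)) ∧
  (∀ D, Integrable (M.avgGap P ε θ π seed D) P) ∧
  Tendsto (M.regret P ε θ π seed) atTop (𝓝 0)

end Market

end VehicleService

end

/-! The shocks have mean zero and law `F`, so the clairvoyant problem coincides with the provider's
problem at the true `θ`. The regret is therefore the Cesàro mean of the expected daily gaps between
`optSol θ` and the policy, and it suffices that these gaps tend to zero (`dailyGap_spec`). The
payoff is Lipschitz in the decision, and the decision of each day is `optSol` of the current
estimate up to a perturbation of order `d ^ (-η)`. Two facts remain.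

Continuity of `optSol`: local balance eliminates the prices, and the objective becomes a strongly
concave quadratic in the supplies on a polyhedron. Comparing the optima of two nearby parameters
with each other gives `exists_optSol_supply_stability`.

Mean-square consistency of the estimates (`tendsto_integral_sqDist`): the two prices of each pair of
days differ by at least a multiple of `d ^ (-η)`, so after `K` pairs the information in every
direction is at least of order `K ^ (1 - 2 * η)` (`exists_info_bound`). The noise, measured in the
inverse regularized Gram matrix, is at most a mean-zero martingale plus a multiple of the
log-determinant (`noiseNorm_le`), which is `O(log K)`. The expected squared error is thus `O(log K /
K ^ (1 - 2 * η))`, and it vanishes because `η < 1 / 2`. -/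

namespace VehicleService

namespace Market

variable {N : ℕ} (M : Market N)

/-! ### The provider's problem as a strictly concave problem in the supplies -/

/-- The expected shortfall `𝔼[max (-s) 0]` of the demand below its mean. -/
noncomputable def shortfall (e : Link N) : ℝ := -∫ s, min s 0 ∂(M.F e)

/-- The expected profit on a link at supply `x` under local supply-demand balance, for the demand
parameters `t` and the expected shortfall `m`. -/
noncomputable def linkProfit (c m : ℝ) (t : ℝ × ℝ) (x : ℝ) : ℝ :=
  (x - m) * ((t.1 - x) / t.2) - x * c

/-- The objective as a function of the supplies. -/
noncomputable def supplyObjective (θ : Params N) (w : Link N → ℝ) : ℝ :=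
  ∑ e, M.ξ e * linkProfit M.c (M.shortfall e) (θ e) (w e)

/-- The supplies of balanced decisions. -/
def Admissible (θ : Params N) (w : Link N → ℝ) : Prop :=
  (∀ e, 0 ≤ w e) ∧ (∀ e, (θ e).1 - (θ e).2 * M.pmax ≤ w e) ∧ FlowBalance w

/-- The parameters all of whose components lie in the rectangle `M.paramSet`. -/
def box : Set (Params N) := {θ | ∀ e, θ e ∈ M.paramSet}

/-- The balanced decision with given supplies. -/
noncomputable def ofSupply (θ : Params N) (w : Link N → ℝ) : Decision N :=
  ⟨fun e => ((θ e).1 - w e) / (θ e).2, w⟩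

lemma pmax_pos : 0 < M.pmax := M.c_pos.trans M.c_lt_pmax

lemma integrable_id_shock (e : Link N) : Integrable (fun s : ℝ => s) (M.F e) := by
  have := M.F_prob e
  refine Integrable.of_bound (by fun_prop) (max |M.εlo| |M.εhi|) ?_
  filter_upwards [M.F_supp e] with s hs
  exact abs_le_max_abs_abs hs.1 hs.2

lemma integrable_min_shock (e : Link N) : Integrable (fun s : ℝ => min s 0) (M.F e) := by
  have := M.F_prob e
  exact (M.integrable_id_shock e).inf (integrable_const 0)

lemma shortfall_nonneg (e : Link N) : 0 ≤ M.shortfall e := by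
  have : ∫ s, min s 0 ∂(M.F e) ≤ 0 := integral_nonpos fun s => min_le_right _ _
  unfold shortfall
  linarith

variable {M} in
lemma mem_box_bounds {θ : Params N} (hθ : θ ∈ M.box) (e : Link N) :
    (M.αmin ≤ (θ e).1 ∧ (θ e).1 ≤ M.αmax) ∧ M.βmin ≤ (θ e).2 ∧ (θ e).2 ≤ M.βmax := by
  exact hθ e

variable {M} in
lemma slope_pos {θ : Params N} (hθ : θ ∈ M.box) (e : Link N) : 0 < (θ e).2 :=
  M.βmin_pos.trans_le (mem_box_bounds hθ e).2.1

variable {M} in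
-- At local balance the sales are the supply plus `min s 0`: uncertainty costs a constant that
-- depends on neither the decision nor the parameters.
lemma integral_min_demand {θ : Params N} {x : Decision N} (e : Link N)
    (hx : x.supply e = (θ e).1 - (θ e).2 * x.price e) :
    ∫ s, min (demand θ e (x.price e) s) (x.supply e) ∂(M.F e)
      = x.supply e - M.shortfall e := by
  have := M.F_prob e
  have h : ∀ s, min (demand θ e (x.price e) s) (x.supply e) = x.supply e + min s 0 := by
    intro s
    rw [demand, ← hx, ← min_add_add_left, add_zero]
  simp_rw [h]
  rw [integral_add (integrable_const _) (M.integrable_min_shock e)]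
  simp [shortfall]

variable {M} in
lemma objective_eq {θ : Params N} (hθ : θ ∈ M.box) {x : Decision N}
    (hx : ∀ e, x.supply e = (θ e).1 - (θ e).2 * x.price e) :
    M.objective θ x = M.supplyObjective θ x.supply := by
  unfold objective supplyObjective linkProfit
  rw [← Finset.sum_sub_distrib]
  refine Finset.sum_congr rfl fun e _ => ?_
  rw [integral_min_demand e (hx e)]
  have hb := slope_pos hθ e
  have hp : ((θ e).1 - x.supply e) / (θ e).2 = x.price e := by
    rw [hx e]; field_simp; ring
  rw [hp]
  ring

variable {M} in
lemma balanced_ofSupply {θ : Params N} (hθ : θ ∈ M.box) {w : Link N → ℝ}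
    (hw : M.Admissible θ w) : M.Balanced θ (ofSupply θ w) := by
  refine ⟨⟨fun e => ?_, hw.1, hw.2.2⟩, fun e => ?_⟩
  · have hb := slope_pos hθ e
    have := hw.2.1 e
    simp only [ofSupply]
    rw [div_le_iff₀ hb]
    linarith
  · have hb := slope_pos hθ e
    simp only [ofSupply]
    field_simp
    ring

variable {M} in
lemma Balanced.admissible {θ : Params N} (hθ : θ ∈ M.box) {x : Decision N}
    (hx : M.Balanced θ x) : M.Admissible θ x.supply := by
  refine ⟨hx.1.2.1, fun e => ?_, hx.1.2.2⟩
  have hb := slope_pos hθ e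
  have := mul_le_mul_of_nonneg_left (hx.1.1 e) hb.le
  rw [hx.2 e]
  linarith

variable {M} in
lemma Balanced.price_eq {θ : Params N} (hθ : θ ∈ M.box) {x : Decision N}
    (hx : M.Balanced θ x) (e : Link N) : x.price e = ((θ e).1 - x.supply e) / (θ e).2 := by
  have hb := slope_pos hθ e
  rw [hx.2 e]
  field_simp
  ring

/-- Reversing links matches the outgoing links of a location with its incoming ones. Hence raising
all supplies equally preserves flow balance. -/
lemma sum_const_origin_eq (i : Fin N) (r : ℝ) :
    ∑ _e : Link N with _e.1.1 = i, r = ∑ _e : Link N with _e.1.2 = i, r := by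
  refine Finset.sum_bij' (fun e _ => (⟨e.1.swap, e.2.symm⟩ : Link N))
    (fun e _ => (⟨e.1.swap, e.2.symm⟩ : Link N)) ?_ ?_ ?_ ?_ ?_ <;> simp

lemma FlowBalance.add_const {w : Link N → ℝ} (hw : FlowBalance w) (r : ℝ) :
    FlowBalance fun e => w e + r := by
  intro i
  rw [Finset.sum_add_distrib, Finset.sum_add_distrib, hw i, sum_const_origin_eq]

variable {M} in
-- A reference point common to all parameters in the box, against which optimal supplies are
-- compared.
lemma admissible_const {θ : Params N} (hθ : θ ∈ M.box) :
    M.Admissible θ fun _ => M.αmax := by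
  refine ⟨fun e => ?_, fun e => ?_, fun i => sum_const_origin_eq i _⟩
  all_goals
    have h := mem_box_bounds hθ e
    have hα := M.αmin_pos
    have hp := mul_pos (slope_pos hθ e) M.pmax_pos
    linarith

/-! ### Coercivity and existence of optimal solutions -/

/-- A supply at which the link profit is at least that at the supply `A` is bounded. -/
lemma linkProfit_le {c m : ℝ} (hc : 0 ≤ c) (hm : 0 ≤ m) {t : ℝ × ℝ} {A μ b₀ b₁ x : ℝ}
    (hA : t.1 ≤ A) (ht : 0 ≤ t.1) (hμ : m ≤ μ) (hb₀ : 0 < b₀) (hb : b₀ ≤ t.2) (hb₁ : t.2 ≤ b₁)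
    (hx : 0 ≤ x) :
    linkProfit c m t x ≤ (A + μ) ^ 2 / (2 * b₀) - x ^ 2 / (2 * b₁) := by
  have hb' : 0 < t.2 := hb₀.trans_le hb
  -- Young's inequality `x * (t.1 + m) ≤ (x ^ 2 + (t.1 + m) ^ 2) / 2` keeps half of the term `-x ^
  -- 2`.
  have h1 : (x - m) * (t.1 - x) ≤ (A + μ) ^ 2 / 2 - x ^ 2 / 2 := by
    have h2 : (t.1 + m) ^ 2 ≤ (A + μ) ^ 2 := by gcongr
    nlinarith [sq_nonneg (x - (t.1 + m)), mul_nonneg hm ht]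
  have h3 : (A + μ) ^ 2 / 2 / t.2 ≤ (A + μ) ^ 2 / (2 * b₀) := by
    rw [div_div]; gcongr
  have h4 : x ^ 2 / (2 * b₁) ≤ x ^ 2 / 2 / t.2 := by
    rw [div_div]; gcongr
  have h5 : (x - m) * (t.1 - x) / t.2 ≤ ((A + μ) ^ 2 / 2 - x ^ 2 / 2) / t.2 := by gcongr
  rw [sub_div] at h5
  have h6 := mul_nonneg hx hc
  unfold linkProfit
  rw [← mul_div_assoc]
  linarith

lemma le_linkProfit {c m : ℝ} (hm : 0 ≤ m) {t : ℝ × ℝ} {A b₀ : ℝ}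
    (hA : t.1 ≤ A) (ht : 0 ≤ t.1) (hb₀ : 0 < b₀) (hb : b₀ ≤ t.2) :
    -(A ^ 2 / b₀) - A * c ≤ linkProfit c m t A := by
  have hb' : 0 < t.2 := hb₀.trans_le hb
  have h1 : -(A ^ 2) ≤ (A - m) * (t.1 - A) := by
    nlinarith [mul_nonneg hm (sub_nonneg.2 hA), mul_nonneg (ht.trans hA) ht]
  have h2 : A ^ 2 / t.2 ≤ A ^ 2 / b₀ := by gcongr
  have h3 : -(A ^ 2) / t.2 ≤ (A - m) * (t.1 - A) / t.2 := by gcongr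
  rw [neg_div] at h3
  unfold linkProfit
  rw [← mul_div_assoc]
  linarith

/-- The profit decreases quadratically in each supply, so beating the reference supply `αmax` bounds
`∑ ξ * w ^ 2`. The bound is uniform over the box, which later makes all decisions and Lipschitz
constants uniform in the estimates. -/
lemma exists_supply_bound : ∃ W, 0 ≤ W ∧ ∀ θ ∈ M.box, ∀ w, M.Admissible θ w →
    M.supplyObjective θ (fun _ => M.αmax) ≤ M.supplyObjective θ w → ∀ e, w e ≤ W := by
  set μ : ℝ := ∑ e, M.shortfall e
  set A₁ : ℝ := (M.αmax + μ) ^ 2 / (2 * M.βmin)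
  set A₂ : ℝ := M.αmax ^ 2 / M.βmin + M.αmax * M.c
  set K : ℝ := ∑ e, M.ξ e * (A₁ + A₂)
  -- The sum over links serves every link at once; the `1` comes from `w ≤ 1 + w ^ 2`, which avoids
  -- a square root.
  set W : ℝ := 1 + ∑ e, |2 * M.βmax * (K / M.ξ e)|
  refine ⟨W, by positivity, fun θ hθ w hw hG e => ?_⟩
  have hbd := mem_box_bounds hθ
  have hup : ∀ f, linkProfit M.c (M.shortfall f) (θ f) (w f) ≤ A₁ - w f ^ 2 / (2 * M.βmax) :=
    fun f => linkProfit_le M.c_pos.le (M.shortfall_nonneg f) (hbd f).1.2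
      (M.αmin_pos.le.trans (hbd f).1.1)
      (Finset.single_le_sum (f := M.shortfall) (fun i _ => M.shortfall_nonneg i)
        (Finset.mem_univ f)) M.βmin_pos (hbd f).2.1 (hbd f).2.2 (hw.1 f)
  have hlo : ∀ f, -A₂ ≤ linkProfit M.c (M.shortfall f) (θ f) M.αmax := fun f => by
    have := le_linkProfit (c := M.c) (M.shortfall_nonneg f) (hbd f).1.2
      (M.αmin_pos.le.trans (hbd f).1.1) M.βmin_pos (hbd f).2.1
    linarith
  have hβ : 0 < M.βmax := M.βmin_pos.trans_le ((hbd e).2.1.trans (hbd e).2.2)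
  have h1 : ∑ f, M.ξ f * (w f ^ 2 / (2 * M.βmax)) ≤ K := by
    have h2 : ∑ f, M.ξ f * (-A₂) ≤ ∑ f, M.ξ f * (A₁ - w f ^ 2 / (2 * M.βmax)) :=
      (Finset.sum_le_sum fun f _ => mul_le_mul_of_nonneg_left (hlo f) (M.ξ_pos f).le).trans
        (hG.trans (Finset.sum_le_sum fun f _ =>
          mul_le_mul_of_nonneg_left (hup f) (M.ξ_pos f).le))
    rw [← sub_nonneg, ← Finset.sum_sub_distrib] at h2 ⊢
    refine h2.trans (le_of_eq (Finset.sum_congr rfl fun f _ => by ring))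
  have h3 : M.ξ e * (w e ^ 2 / (2 * M.βmax)) ≤ K :=
    (Finset.single_le_sum (f := fun f => M.ξ f * (w f ^ 2 / (2 * M.βmax)))
      (fun f _ => mul_nonneg (M.ξ_pos f).le (by positivity)) (Finset.mem_univ e)).trans h1
  have h4 : w e ^ 2 ≤ 2 * M.βmax * (K / M.ξ e) := by
    have hξ := M.ξ_pos e
    rw [← mul_div_assoc, le_div_iff₀ hξ]
    rw [← mul_div_assoc, div_le_iff₀ (by positivity)] at h3
    linarith
  have h5 : |2 * M.βmax * (K / M.ξ e)| ≤ ∑ f, |2 * M.βmax * (K / M.ξ f)| :=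
    Finset.single_le_sum (f := fun f => |2 * M.βmax * (K / M.ξ f)|)
      (fun f _ => abs_nonneg _) (Finset.mem_univ e)
  have h6 := le_abs_self (2 * M.βmax * (K / M.ξ e))
  have h7 : w e ≤ 1 + w e ^ 2 := by nlinarith [sq_nonneg (w e - 1), sq_nonneg (w e)]
  simp only [W]
  linarith

lemma continuous_supplyObjective (θ : Params N) : Continuous (M.supplyObjective θ) := by
  unfold supplyObjective linkProfit
  fun_prop

lemma isClosed_admissible (θ : Params N) : IsClosed {w | M.Admissible θ w} := by
  have h : {w | M.Admissible θ w} = (⋂ e, {w : Link N → ℝ | 0 ≤ w e}) ∩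
      ((⋂ e, {w : Link N → ℝ | (θ e).1 - (θ e).2 * M.pmax ≤ w e}) ∩
        ⋂ i : Fin N, {w : Link N → ℝ |
          ∑ e : Link N with e.1.1 = i, w e = ∑ e : Link N with e.1.2 = i, w e}) := by
    ext w
    simp [Admissible, FlowBalance]
  rw [h]
  refine (isClosed_iInter fun e => ?_).inter ((isClosed_iInter fun e => ?_).inter
    (isClosed_iInter fun i => ?_))
  · exact isClosed_le (by fun_prop) (by fun_prop)
  · exact isClosed_le (by fun_prop) (by fun_prop)
  · exact isClosed_eq (by fun_prop) (by fun_prop)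

variable {M} in
-- The admissible supplies are unbounded, but those at least as good as the reference supply form a
-- compact set.
lemma exists_maximal_supply {θ : Params N} (hθ : θ ∈ M.box) : ∃ w, M.Admissible θ w ∧
    ∀ u, M.Admissible θ u → M.supplyObjective θ u ≤ M.supplyObjective θ w := by
  obtain ⟨W, -, hW⟩ := M.exists_supply_bound
  set w₀ : Link N → ℝ := fun _ => M.αmax
  have hw₀ : M.Admissible θ w₀ := admissible_const hθ
  set K := {w | M.Admissible θ w} ∩ {w | M.supplyObjective θ w₀ ≤ M.supplyObjective θ w}
  have hK : IsCompact K := by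
    refine (isCompact_Icc (a := (0 : Link N → ℝ)) (b := fun _ => W)).of_isClosed_subset
      ((M.isClosed_admissible θ).inter
        (isClosed_le continuous_const (M.continuous_supplyObjective θ))) ?_
    rintro w ⟨h1, h2⟩
    exact ⟨h1.1, hW θ hθ w h1 h2⟩
  obtain ⟨w, hw, hmax⟩ := hK.exists_isMaxOn ⟨w₀, hw₀, le_refl (M.supplyObjective θ w₀)⟩
    (M.continuous_supplyObjective θ).continuousOn
  refine ⟨w, hw.1, fun u hu => ?_⟩
  by_cases h : M.supplyObjective θ w₀ ≤ M.supplyObjective θ u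
  · exact hmax ⟨hu, h⟩
  · exact (not_le.1 h).le.trans hw.2

variable {M} in
lemma isOptimal_optSol {θ : Params N} (hθ : θ ∈ M.box) : M.IsOptimal θ (M.optSol θ) := by
  refine Classical.epsilon_spec ?_
  obtain ⟨w, hw, hmax⟩ := exists_maximal_supply hθ
  have hb := balanced_ofSupply hθ hw
  refine ⟨ofSupply θ w, hb, fun y hy => ?_⟩
  rw [objective_eq hθ hy.2, objective_eq hθ hb.2]
  exact hmax _ (hy.admissible hθ)

variable {M} in
lemma admissible_optSol {θ : Params N} (hθ : θ ∈ M.box) :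
    M.Admissible θ (M.optSol θ).supply :=
  (isOptimal_optSol hθ).1.admissible hθ

variable {M} in
lemma IsOptimal.supplyObjective_le {θ : Params N} (hθ : θ ∈ M.box) {x : Decision N}
    (hx : M.IsOptimal θ x) {u : Link N → ℝ} (hu : M.Admissible θ u) :
    M.supplyObjective θ u ≤ M.supplyObjective θ x.supply := by
  have := hx.2 _ (balanced_ofSupply hθ hu)
  rwa [objective_eq hθ (balanced_ofSupply hθ hu).2, objective_eq hθ hx.1.2] at this

lemma exists_optSol_supply_bound : ∃ W, 0 ≤ W ∧ ∀ θ ∈ M.box, ∀ e,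
    0 ≤ (M.optSol θ).supply e ∧ (M.optSol θ).supply e ≤ W := by
  obtain ⟨W, hW0, hW⟩ := M.exists_supply_bound
  exact ⟨W, hW0, fun θ hθ e => ⟨(admissible_optSol hθ).1 e, hW θ hθ _ (admissible_optSol hθ)
    ((isOptimal_optSol hθ).supplyObjective_le hθ (admissible_const hθ)) e⟩⟩

/-! ### Strong concavity, stability and continuity of the optimal solution -/

lemma linkProfit_midpoint (c m : ℝ) (t : ℝ × ℝ) (x y : ℝ) :
    linkProfit c m t ((x + y) / 2)
      = (linkProfit c m t x + linkProfit c m t y) / 2 + (x - y) ^ 2 / (4 * t.2) := by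
  unfold linkProfit
  -- Division by zero is zero, so only the affine cost term is left in this case and the identity
  -- persists.
  by_cases h : t.2 = 0
  · simp [h]; ring
  · field_simp
    ring

variable {M} in
lemma Admissible.midpoint {θ : Params N} {u w : Link N → ℝ} (hu : M.Admissible θ u)
    (hw : M.Admissible θ w) : M.Admissible θ fun e => (u e + w e) / 2 := by
  refine ⟨fun e => ?_, fun e => ?_, fun i => ?_⟩
  · linarith [hu.1 e, hw.1 e]
  · linarith [hu.2.1 e, hw.2.1 e]
  · rw [← Finset.sum_div, ← Finset.sum_div, Finset.sum_add_distrib, Finset.sum_add_distrib,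
      hu.2.2 i, hw.2.2 i]

variable {M} in
/-- Strong concavity: the objective gap dominates the squared distance to an optimal solution. -/
lemma IsOptimal.sum_sq_le {θ : Params N} (hθ : θ ∈ M.box) {x : Decision N}
    (hx : M.IsOptimal θ x) {u : Link N → ℝ} (hu : M.Admissible θ u) :
    ∑ e, M.ξ e * ((u e - x.supply e) ^ 2 / (2 * (θ e).2))
      ≤ M.supplyObjective θ x.supply - M.supplyObjective θ u := by
  -- The midpoint of `u` and the optimum is admissible and cannot beat the optimum; the exact
  -- midpoint identity turns this into the quadratic bound.
  have h := hx.supplyObjective_le hθ (hu.midpoint (hx.1.admissible hθ))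
  have h2 : M.supplyObjective θ (fun e => (u e + x.supply e) / 2)
      = (M.supplyObjective θ u + M.supplyObjective θ x.supply) / 2
        + (∑ e, M.ξ e * ((u e - x.supply e) ^ 2 / (2 * (θ e).2))) / 2 := by
    unfold supplyObjective
    rw [← Finset.sum_add_distrib, Finset.sum_div, Finset.sum_div, ← Finset.sum_add_distrib]
    refine Finset.sum_congr rfl fun e _ => ?_
    rw [linkProfit_midpoint]
    ring
  linarith

/-- The link profit is Lipschitz along a joint change of parameters and supply. -/
lemma abs_linkProfit_sub_le {c m : ℝ} {t t' : ℝ × ℝ} {x r δ b A W R μ : ℝ}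
    (hc : 0 ≤ c) (hm : 0 ≤ m) (hμ : m ≤ μ) (hb : 0 < b) (ht2 : b ≤ t.2) (ht2' : b ≤ t'.2)
    (ht0 : 0 ≤ t.1) (ht : t.1 ≤ A) (hx : 0 ≤ x) (hxW : x ≤ W) (hδ : 0 ≤ δ) (hδ1 : δ ≤ 1)
    (h1 : |t.1 - t'.1| ≤ δ) (h2 : |t.2 - t'.2| ≤ δ) (hR : 0 ≤ R) (hr : r = R * δ) :
    |linkProfit c m t x - linkProfit c m t' (x + r)|
      ≤ δ * ((W + μ) * ((1 + R + (A + W) / b) / b)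
        + R * ((A + W) / b + (1 + R + (A + W) / b) / b) + R * c) := by
  have hb1 : 0 < t.2 := hb.trans_le ht2
  have hb2 : 0 < t'.2 := hb.trans_le ht2'
  have hA : 0 ≤ A := ht0.trans ht
  have hW : 0 ≤ W := hx.trans hxW
  set P := (A + W) / b with hP
  set K := (1 + R + P) / b with hK
  have hP0 : 0 ≤ P := by positivity
  have hK0 : 0 ≤ K := by positivity
  set p := (t.1 - x) / t.2 with hp
  set p' := (t'.1 - (x + r)) / t'.2 with hp'
  have hpP : |p| ≤ P := by
    rw [hp, abs_div, abs_of_pos hb1, hP]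
    have : |t.1 - x| ≤ A + W := by rw [abs_le]; constructor <;> linarith
    gcongr
  have hpp : |p - p'| ≤ δ * K := by
    have e1 : p - p' = (t.1 - t'.1 + r + (t'.2 - t.2) * p) / t'.2 := by
      rw [hp', hp]; field_simp; ring
    have e2 : |t.1 - t'.1 + r + (t'.2 - t.2) * p| ≤ δ * (1 + R + P) := by
      have e3 : |(t'.2 - t.2) * p| ≤ δ * P := by
        rw [abs_mul, abs_sub_comm]; gcongr
      have e4 : |r| = R * δ := by rw [hr, abs_of_nonneg (by positivity)]
      calc _ ≤ |t.1 - t'.1| + |r| + |(t'.2 - t.2) * p| := abs_add_three _ _ _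
        _ ≤ δ + R * δ + δ * P := by rw [e4]; gcongr
        _ = _ := by ring
    rw [e1, abs_div, abs_of_pos hb2]
    calc _ ≤ δ * (1 + R + P) / b := div_le_div₀ (by positivity) e2 hb ht2'
      _ = δ * K := by rw [hK, mul_div_assoc]
  have hδK : δ * K ≤ K := by nlinarith
  have hp'P : |p'| ≤ P + K := by
    have : |p'| ≤ |p| + |p - p'| := by
      have := abs_sub p (p - p'); simpa using this
    linarith
  -- Here `p` and `p'` are the balancing prices, and the profit is `(x - m) * p - x * c`; this is
  -- the product rule for the difference.
  have key : linkProfit c m t x - linkProfit c m t' (x + r)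
      = (x - m) * (p - p') + (-(r * p')) + r * c := by
    simp only [linkProfit, ← hp, ← hp']; ring
  have hxm : |x - m| ≤ W + μ := by rw [abs_le]; constructor <;> linarith
  have hr0 : 0 ≤ r := by rw [hr]; positivity
  have hWμ : 0 ≤ W + μ := by linarith
  rw [key]
  calc _ ≤ |(x - m) * (p - p')| + |-(r * p')| + |r * c| := abs_add_three _ _ _
    _ = |x - m| * |p - p'| + r * |p'| + r * c := by
      rw [abs_neg, abs_mul, abs_mul, abs_mul, abs_of_nonneg hr0, abs_of_nonneg hc]
    _ ≤ (W + μ) * (δ * K) + r * (P + K) + r * c := by gcongr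
    _ = _ := by rw [hr]; ring

lemma abs_fst_sub_le (θ ϑ : Params N) (e : Link N) : |(θ e).1 - (ϑ e).1| ≤ ‖θ - ϑ‖ :=
  (norm_fst_le (θ e - ϑ e)).trans (norm_le_pi_norm (θ - ϑ) e)

lemma abs_snd_sub_le (θ ϑ : Params N) (e : Link N) : |(θ e).2 - (ϑ e).2| ≤ ‖θ - ϑ‖ :=
  (norm_snd_le (θ e - ϑ e)).trans (norm_le_pi_norm (θ - ϑ) e)

variable {M} in
-- The price cap requires `w ≥ α - β * pmax`, a bound that moves by at most `(1 + pmax) * ‖θ - ϑ‖`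
-- between the parameters. A uniform raise by that amount restores it and keeps flow balance.
lemma Admissible.shift {θ ϑ : Params N} {w : Link N → ℝ} (hw : M.Admissible θ w) :
    M.Admissible ϑ fun e => w e + (1 + M.pmax) * ‖θ - ϑ‖ := by
  have hp := M.pmax_pos
  have hn := norm_nonneg (θ - ϑ)
  refine ⟨fun e => add_nonneg (hw.1 e) (by positivity), fun e => ?_, FlowBalance.add_const hw.2.2 _⟩
  have h1 := (abs_le.1 (abs_fst_sub_le θ ϑ e)).1
  have h2 := (abs_le.1 (abs_snd_sub_le θ ϑ e)).2
  have h3 := hw.2.1 e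
  nlinarith

/-- Stability of the optimal supplies. -/
lemma exists_optSol_supply_stability : ∃ C, ∀ θ ∈ M.box, ∀ ϑ ∈ M.box, ‖θ - ϑ‖ ≤ 1 → ∀ e,
    ((M.optSol ϑ).supply e + (1 + M.pmax) * ‖θ - ϑ‖ - (M.optSol θ).supply e) ^ 2
      ≤ C * ‖θ - ϑ‖ := by
  obtain ⟨W, hW0, hW⟩ := M.exists_optSol_supply_bound
  set μ : ℝ := ∑ e, M.shortfall e
  have hμ : ∀ e, M.shortfall e ≤ μ := fun e =>
    Finset.single_le_sum (f := M.shortfall) (fun i _ => M.shortfall_nonneg i) (Finset.mem_univ e)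
  have hp := M.pmax_pos
  set R := 1 + M.pmax
  set A := M.αmax
  set b := M.βmin
  set Lc := (W + μ) * ((1 + R + (A + W) / b) / b)
    + R * ((A + W) / b + (1 + R + (A + W) / b) / b) + R * M.c
  set S := ∑ e, M.ξ e * (2 * Lc)
  refine ⟨∑ e, |2 * M.βmax / M.ξ e * S|, fun θ hθ ϑ hϑ hle e => ?_⟩
  set δ := ‖θ - ϑ‖
  have hδ : 0 ≤ δ := norm_nonneg _
  have hlip : ∀ f, ∀ t ∈ M.box, ∀ t' ∈ M.box, ‖t - t'‖ = δ → ∀ x, 0 ≤ x → x ≤ W →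
      |linkProfit M.c (M.shortfall f) (t f) x - linkProfit M.c (M.shortfall f) (t' f) (x + R * δ)|
        ≤ δ * Lc := by
    intro f t ht t' ht' heq x hx0 hxW
    have h1 := mem_box_bounds ht f
    have h2 := mem_box_bounds ht' f
    exact abs_linkProfit_sub_le M.c_pos.le (M.shortfall_nonneg f) (hμ f) M.βmin_pos h1.2.1 h2.2.1
      (M.αmin_pos.le.trans h1.1.1) h1.1.2 hx0 hxW hδ hle
      ((abs_fst_sub_le t t' f).trans heq.le) ((abs_snd_sub_le t t' f).trans heq.le)
      (by positivity) rfl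
  set w := (M.optSol θ).supply
  set v := (M.optSol ϑ).supply
  have hv := admissible_optSol hϑ
  have hsw : ‖ϑ - θ‖ = δ := norm_sub_rev _ _
  have hv' : M.Admissible θ fun e => v e + R * δ := hsw ▸ hv.shift
  have hw' : M.Admissible ϑ fun e => w e + R * δ := (admissible_optSol hθ).shift
  have h1 := (isOptimal_optSol hθ).sum_sq_le hθ hv'
  have h2 := (isOptimal_optSol hϑ).supplyObjective_le hϑ hw'
  -- Exchange argument: each shifted optimum competes in the other problem. By `h2` the `ϑ`-terms
  -- are bounded below by zero together, so the suboptimality of the shifted `v` at `θ` is at most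
  -- `δ * S`, and `h1` converts it into a squared distance.
  have h3 : M.supplyObjective θ w - M.supplyObjective ϑ (fun e => w e + R * δ)
      + (M.supplyObjective ϑ v - M.supplyObjective θ fun e => v e + R * δ) ≤ δ * S := by
    unfold supplyObjective
    rw [← Finset.sum_sub_distrib, ← Finset.sum_sub_distrib, ← Finset.sum_add_distrib,
      Finset.mul_sum]
    refine Finset.sum_le_sum fun f _ => ?_
    have i1 := (le_abs_self _).trans (hlip f θ hθ ϑ hϑ rfl _ (hW θ hθ f).1 (hW θ hθ f).2)
    have i2 := (le_abs_self _).trans (hlip f ϑ hϑ θ hθ hsw _ (hW ϑ hϑ f).1 (hW ϑ hϑ f).2)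
    have := mul_le_mul_of_nonneg_left (add_le_add i1 i2) (M.ξ_pos f).le
    linarith
  have h4 : ∑ f, M.ξ f * ((v f + R * δ - w f) ^ 2 / (2 * (θ f).2)) ≤ δ * S := by
    linarith
  have h5 : M.ξ e * ((v e + R * δ - w e) ^ 2 / (2 * (θ e).2)) ≤ δ * S :=
    (Finset.single_le_sum (f := fun f => M.ξ f * ((v f + R * δ - w f) ^ 2 / (2 * (θ f).2)))
      (fun f _ => mul_nonneg (M.ξ_pos f).le
        (div_nonneg (sq_nonneg _) (by linarith [slope_pos hθ f]))) (Finset.mem_univ e)).trans h4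
  have hξ := M.ξ_pos e
  have hb := slope_pos hθ e
  have hbm := (mem_box_bounds hθ e).2.2
  have h6 : (v e + R * δ - w e) ^ 2 ≤ 2 * M.βmax / M.ξ e * S * δ := by
    have h0 : 0 ≤ δ * S := le_trans (by positivity) h5
    rw [← mul_div_assoc, div_le_iff₀ (by positivity)] at h5
    have : 2 * M.βmax / M.ξ e * S * δ = (δ * S * (2 * M.βmax)) / M.ξ e := by ring
    rw [this, le_div_iff₀ hξ]
    nlinarith
  refine h6.trans (mul_le_mul_of_nonneg_right ((le_abs_self _).trans ?_) hδ)
  exact Finset.single_le_sum (f := fun f => |2 * M.βmax / M.ξ f * S|)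
      (fun f _ => abs_nonneg _) (Finset.mem_univ e)

/-- The squared shifted distance is `O(‖θ - ϑ‖)`, and the shift vanishes too. Continuity is used for
the measurability of the decisions as well as for their convergence. -/
lemma continuousOn_optSol_supply (e : Link N) :
    ContinuousOn (fun θ => (M.optSol θ).supply e) M.box := by
  obtain ⟨C, hC⟩ := M.exists_optSol_supply_stability
  intro θ hθ
  have hn : Tendsto (fun ϑ : Params N => ‖θ - ϑ‖) (𝓝[M.box] θ) (𝓝 0) := by
    have : Continuous fun ϑ : Params N => ‖θ - ϑ‖ := by fun_prop
    simpa using (this.tendsto θ).mono_left nhdsWithin_le_nhds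
  set g : Params N → ℝ := fun ϑ =>
    (M.optSol ϑ).supply e + (1 + M.pmax) * ‖θ - ϑ‖ - (M.optSol θ).supply e
  have hg2 : Tendsto (fun ϑ => g ϑ ^ 2) (𝓝[M.box] θ) (𝓝 0) := by
    refine squeeze_zero' (Eventually.of_forall fun ϑ => sq_nonneg _) ?_
      (by simpa using hn.const_mul C)
    filter_upwards [self_mem_nhdsWithin, hn.eventually (gt_mem_nhds one_pos)] with ϑ hϑ h1
    exact hC θ hθ ϑ hϑ h1.le e
  have hg : Tendsto g (𝓝[M.box] θ) (𝓝 0) := by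
    rw [tendsto_zero_iff_abs_tendsto_zero]
    have := hg2.sqrt
    simpa [Real.sqrt_sq_eq_abs, Function.comp_def] using this
  have := (hg.sub (hn.const_mul (1 + M.pmax))).add_const ((M.optSol θ).supply e)
  simp only [mul_zero, sub_zero, zero_add] at this
  refine this.congr fun ϑ => ?_
  simp only [g]; ring

lemma continuousOn_optSol_price (e : Link N) :
    ContinuousOn (fun θ => (M.optSol θ).price e) M.box := by
  have h : ContinuousOn (fun θ : Params N => ((θ e).1 - (M.optSol θ).supply e) / (θ e).2) M.box :=
    (ContinuousOn.sub (by fun_prop) (M.continuousOn_optSol_supply e)).div (by fun_prop)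
      fun θ hθ => (slope_pos hθ e).ne'
  exact h.congr fun θ hθ => (isOptimal_optSol hθ).1.price_eq hθ e

lemma exists_optSol_bound : ∃ B, 0 ≤ B ∧ ∀ θ ∈ M.box, ∀ e,
    |(M.optSol θ).supply e| ≤ B ∧ |(M.optSol θ).price e| ≤ B := by
  obtain ⟨W, hW0, hW⟩ := M.exists_optSol_supply_bound
  have hb := M.βmin_pos
  refine ⟨W + (|M.αmax| + W) / M.βmin, by positivity, fun θ hθ e => ?_⟩
  have h1 := mem_box_bounds hθ e
  have h2 := hW θ hθ e
  have h0 : 0 ≤ (|M.αmax| + W) / M.βmin := by positivity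
  refine ⟨by rw [abs_of_nonneg h2.1]; linarith, ?_⟩
  rw [(isOptimal_optSol hθ).1.price_eq hθ e, abs_div, abs_of_pos (slope_pos hθ e)]
  have h3 : |(θ e).1 - (M.optSol θ).supply e| ≤ |M.αmax| + W := by
    have := le_abs_self M.αmax
    have := M.αmin_pos
    rw [abs_le]; constructor <;> linarith
  have h4 : |(θ e).1 - (M.optSol θ).supply e| / (θ e).2 ≤ (|M.αmax| + W) / M.βmin := by
    gcongr
    exact h1.2.1
  linarith

end Market

/-! ### Ridge-regularized Gram matrices for the regressors `(1, q k)`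

The Gram matrix `1 + ∑ k < n, (1, q k) (1, q k)ᵀ` has the entries `gramOne n`, `gramCross q n` and
`gramSq q n`; the vector `∑ k < n, z k • (1, q k)` has the entries `noiseSum z n` and
`noiseCross q z n`. -/

/-- The upper left entry of the Gram matrix. -/
noncomputable def gramOne (n : ℕ) : ℝ := 1 + n

/-- The off-diagonal entry of the Gram matrix. -/
noncomputable def gramCross (q : ℕ → ℝ) (n : ℕ) : ℝ := ∑ k ∈ Finset.range n, q k

/-- The lower right entry of the Gram matrix. -/
noncomputable def gramSq (q : ℕ → ℝ) (n : ℕ) : ℝ := 1 + ∑ k ∈ Finset.range n, q k ^ 2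

/-- The determinant of the Gram matrix. -/
noncomputable def gramDet (q : ℕ → ℝ) (n : ℕ) : ℝ := gramOne n * gramSq q n - gramCross q n ^ 2

/-- The first entry of the weighted noise vector. -/
noncomputable def noiseSum (z : ℕ → ℝ) (n : ℕ) : ℝ := ∑ k ∈ Finset.range n, z k

/-- The second entry of the weighted noise vector. -/
noncomputable def noiseCross (q z : ℕ → ℝ) (n : ℕ) : ℝ := ∑ k ∈ Finset.range n, q k * z k

/-- The squared norm of the noise vector in the metric of the inverse Gram matrix. -/
noncomputable def noiseNorm (q z : ℕ → ℝ) (n : ℕ) : ℝ :=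
  (gramSq q n * noiseSum z n ^ 2 - 2 * gramCross q n * noiseSum z n * noiseCross q z n
    + gramOne n * noiseCross q z n ^ 2) / gramDet q n

/-- The coefficient of the `n`-th shock in the increment of `noiseNorm`. -/
noncomputable def noiseCoeff (q z : ℕ → ℝ) (n : ℕ) : ℝ :=
  2 * ((gramSq q (n + 1) - gramCross q (n + 1) * q n) * noiseSum z n
    + (gramOne (n + 1) * q n - gramCross q (n + 1)) * noiseCross q z n) / gramDet q (n + 1)

/-- Cauchy–Schwarz for `∑ q k`; the ridge term keeps the determinant away from zero even before any
price variation. -/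
lemma one_le_gramDet (q : ℕ → ℝ) (n : ℕ) : 1 ≤ gramDet q n := by
  have h := sq_sum_le_card_mul_sum_sq (s := Finset.range n) (f := q)
  rw [Finset.card_range] at h
  have h2 : 0 ≤ ∑ k ∈ Finset.range n, q k ^ 2 := Finset.sum_nonneg fun _ _ => sq_nonneg _
  have hn : (0 : ℝ) ≤ n := n.cast_nonneg
  unfold gramDet gramOne gramSq gramCross
  nlinarith

lemma gramDet_pos (q : ℕ → ℝ) (n : ℕ) : 0 < gramDet q n :=
  one_pos.trans_le (one_le_gramDet q n)

lemma gramOne_pos (n : ℕ) : 0 < gramOne n := by unfold gramOne; positivity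

/-- Rank-one update of the inverse Gram matrix `V n`. With `v = (1, q n)`, the weight of `z n ^ 2`
is `vᵀ V(n+1)⁻¹ v = 1 - det V(n) / det V(n+1)`. The discarded remainder is the decrease of the old
noise norm under the new metric, a square divided by the two determinants. -/
lemma noiseNorm_succ_le (q z : ℕ → ℝ) (n : ℕ) :
    noiseNorm q z (n + 1) ≤ noiseNorm q z n + noiseCoeff q z n * z n
      + z n ^ 2 * (1 - gramDet q n / gramDet q (n + 1)) := by
  have hD := gramDet_pos q n
  have hD' := gramDet_pos q (n + 1)
  have e0 : gramOne (n + 1) = gramOne n + 1 := by simp [gramOne]; ring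
  have e1 : gramCross q (n + 1) = gramCross q n + q n := by
    simp [gramCross, Finset.sum_range_succ]
  have e2 : gramSq q (n + 1) = gramSq q n + q n ^ 2 := by
    simp [gramSq, Finset.sum_range_succ]; ring
  have e3 : noiseSum z (n + 1) = noiseSum z n + z n := by
    simp [noiseSum, Finset.sum_range_succ]
  have e4 : noiseCross q z (n + 1) = noiseCross q z n + q n * z n := by
    simp [noiseCross, Finset.sum_range_succ]
  have key : noiseNorm q z n + noiseCoeff q z n * z n
      + z n ^ 2 * (1 - gramDet q n / gramDet q (n + 1)) - noiseNorm q z (n + 1)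
      = ((gramSq q n - gramCross q n * q n) * noiseSum z n
        + (gramOne n * q n - gramCross q n) * noiseCross q z n) ^ 2
        / (gramDet q n * gramDet q (n + 1)) := by
    unfold noiseNorm noiseCoeff
    rw [e0, e1, e2, e3, e4]
    have f : gramDet q n = gramOne n * gramSq q n - gramCross q n ^ 2 := rfl
    have f' : gramDet q (n + 1)
        = (gramOne n + 1) * (gramSq q n + q n ^ 2) - (gramCross q n + q n) ^ 2 := by
      rw [gramDet, e0, e1, e2]
    generalize gramDet q (n + 1) = d' at *
    generalize gramDet q n = d at *
    generalize gramOne n = a at *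
    generalize gramSq q n = b at *
    generalize gramCross q n = c at *
    generalize noiseSum z n = s at *
    generalize noiseCross q z n = t at *
    generalize q n = x at *
    generalize z n = y at *
    have h1 := hD.ne'
    have h2 := hD'.ne'
    field_simp
    rw [f, f']
    ring
  have : 0 ≤ ((gramSq q n - gramCross q n * q n) * noiseSum z n
        + (gramOne n * q n - gramCross q n) * noiseCross q z n) ^ 2
        / (gramDet q n * gramDet q (n + 1)) := by positivity
  linarith

/-- From `log y ≤ y - 1`; it makes the weights of the squared shocks telescope. -/
lemma one_sub_gramDet_div_le (q : ℕ → ℝ) (n : ℕ) :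
    1 - gramDet q n / gramDet q (n + 1)
      ≤ Real.log (gramDet q (n + 1)) - Real.log (gramDet q n) := by
  have hD := gramDet_pos q n
  have hD' := gramDet_pos q (n + 1)
  have h := Real.log_le_sub_one_of_pos (div_pos hD hD')
  rw [Real.log_div hD.ne' hD'.ne'] at h
  linarith

lemma gramDet_div_le_one (q : ℕ → ℝ) (n : ℕ) : gramDet q n / gramDet q (n + 1) ≤ 1 := by
  rw [div_le_one (gramDet_pos q (n + 1))]
  -- The gain in the determinant is a quadratic in `q n`; multiplying by `gramOne n` completes the
  -- square.
  have h : gramDet q (n + 1) * gramOne n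
      = gramDet q n * gramOne n + (gramDet q n + (gramOne n * q n - gramCross q n) ^ 2) := by
    simp only [gramDet, gramOne, gramSq, gramCross, Finset.sum_range_succ]
    push_cast
    ring
  have := gramDet_pos q n
  have := gramOne_pos n
  have := sq_nonneg (gramOne n * q n - gramCross q n)
  nlinarith

lemma gramDet_le {q : ℕ → ℝ} {B : ℝ} (hq : ∀ k, |q k| ≤ B) (n : ℕ) :
    gramDet q n ≤ (1 + n) * (1 + n * B ^ 2) := by
  have h : ∑ k ∈ Finset.range n, q k ^ 2 ≤ n * B ^ 2 := by
    have := Finset.sum_le_card_nsmul (Finset.range n) (fun k => q k ^ 2) (B ^ 2)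
      fun k _ => sq_le_sq.2 ((hq k).trans (le_abs_self B))
    simpa using this
  have hn : (0 : ℝ) ≤ n := n.cast_nonneg
  unfold gramDet gramOne gramSq
  have := sq_nonneg (gramCross q n)
  nlinarith

/-- The self-normalized bound: up to a martingale, `noiseNorm` grows at most logarithmically. -/
lemma noiseNorm_le {q z : ℕ → ℝ} {B : ℝ} (hz : ∀ k, |z k| ≤ B) (n : ℕ) :
    noiseNorm q z n
      ≤ ∑ k ∈ Finset.range n, noiseCoeff q z k * z k + B ^ 2 * Real.log (gramDet q n) := by
  induction n with
  | zero => simp [noiseNorm, noiseSum, noiseCross, gramDet, gramOne, gramSq, gramCross]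
  | succ n ih =>
    have h1 := noiseNorm_succ_le q z n
    have h2 := one_sub_gramDet_div_le q n
    have h3 := gramDet_div_le_one q n
    have h4 : z n ^ 2 ≤ B ^ 2 := sq_le_sq.2 ((hz n).trans (le_abs_self B))
    have h5 : z n ^ 2 * (1 - gramDet q n / gramDet q (n + 1))
        ≤ B ^ 2 * (Real.log (gramDet q (n + 1)) - Real.log (gramDet q n)) :=
      mul_le_mul h4 h2 (by linarith) (sq_nonneg _)
    rw [Finset.sum_range_succ]
    linarith

/-- The Cauchy–Schwarz inequality for the Gram matrix and its inverse. -/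
lemma sq_le_gram_mul_noiseNorm (q z : ℕ → ℝ) (n : ℕ) (u₁ u₂ : ℝ) :
    (u₁ * noiseSum z n + u₂ * noiseCross q z n) ^ 2
      ≤ (gramOne n * u₁ ^ 2 + 2 * gramCross q n * u₁ * u₂ + gramSq q n * u₂ ^ 2)
        * noiseNorm q z n := by
  have hD := gramDet_pos q n
  rw [noiseNorm, ← mul_div_assoc, le_div_iff₀ hD]
  have h := sq_nonneg ((gramOne n * u₁ + gramCross q n * u₂) * noiseCross q z n
    - (gramCross q n * u₁ + gramSq q n * u₂) * noiseSum z n)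
  unfold gramDet
  linarith

lemma gram_form_eq (q : ℕ → ℝ) (n : ℕ) (u₁ u₂ : ℝ) :
    gramOne n * u₁ ^ 2 + 2 * gramCross q n * u₁ * u₂ + gramSq q n * u₂ ^ 2
      = u₁ ^ 2 + u₂ ^ 2 + ∑ k ∈ Finset.range n, (u₁ + u₂ * q k) ^ 2 := by
  induction n with
  | zero => simp [gramOne, gramSq, gramCross]
  | succ n ih =>
    rw [Finset.sum_range_succ, ← add_assoc, ← ih]
    simp only [gramOne, gramSq, gramCross, Finset.sum_range_succ]
    push_cast
    ring

/-- The estimation error of least squares in terms of the self-normalized noise. -/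
lemma mul_sq_le_noiseNorm {q z : ℕ → ℝ} {n : ℕ} {u₁ u₂ lam : ℝ} (hlam : 1 ≤ lam)
    (hform : lam * (u₁ ^ 2 + u₂ ^ 2) ≤ ∑ k ∈ Finset.range n, (u₁ + u₂ * q k) ^ 2)
    (hmin : ∑ k ∈ Finset.range n, (z k - (u₁ + u₂ * q k)) ^ 2
      ≤ ∑ k ∈ Finset.range n, z k ^ 2) :
    lam * (u₁ ^ 2 + u₂ ^ 2) ≤ 8 * noiseNorm q z n := by
  set G := ∑ k ∈ Finset.range n, (u₁ + u₂ * q k) ^ 2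
  set y := u₁ * noiseSum z n + u₂ * noiseCross q z n with hy
  have h1 : ∑ k ∈ Finset.range n, (z k - (u₁ + u₂ * q k)) ^ 2
      = ∑ k ∈ Finset.range n, z k ^ 2 - 2 * y + G := by
    simp only [hy, noiseSum, noiseCross, G, mul_add, Finset.mul_sum]
    rw [← Finset.sum_add_distrib, ← Finset.sum_sub_distrib, ← Finset.sum_add_distrib]
    exact Finset.sum_congr rfl fun k _ => by ring
  have h2 := sq_le_gram_mul_noiseNorm q z n u₁ u₂
  rw [gram_form_eq] at h2
  have hu : 0 ≤ u₁ ^ 2 + u₂ ^ 2 := by positivity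
  have h3 : u₁ ^ 2 + u₂ ^ 2 ≤ G := by nlinarith
  have hG : 0 ≤ G := hu.trans h3
  have hQ : 0 ≤ noiseNorm q z n := by
    by_contra hneg
    have h0 := sq_le_gram_mul_noiseNorm q z n 1 0
    have h0' := sq_nonneg (1 * noiseSum z n + 0 * noiseCross q z n)
    have := gramOne_pos n
    have := mul_neg_of_pos_of_neg this (not_le.1 hneg)
    linarith
  refine hform.trans ?_
  rcases hG.eq_or_lt with h | hpos
  · rw [← h]; linarith
  -- Doing no worse than zero error gives `G ≤ 2 * y`. Cauchy–Schwarz bounds `y ^ 2` by the ridge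
  -- form times the noise norm, and `1 ≤ lam` makes the ridge part at most `G`. Together `G ^ 2 ≤ 4
  -- * y ^ 2 ≤ 8 * G * noiseNorm`.
  · have h4 : G ≤ 2 * y := by linarith
    have h5 : y ^ 2 ≤ 2 * G * noiseNorm q z n :=
      h2.trans (mul_le_mul_of_nonneg_right (by linarith) hQ)
    have h6 : G * G ≤ G * (8 * noiseNorm q z n) := by nlinarith
    exact le_of_mul_le_mul_left h6 hpos

/-! ### The least squares estimate -/

namespace Market

variable {N : ℕ} (M : Market N)

/-- The solution of the normal equations of `n` observations with the sums `x`, `xx`, `y`, `xy` of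
the prices, the squared prices, the demands, and the products of prices and demands. -/
noncomputable def normalSol (n x xx y xy : ℝ) : ℝ × ℝ :=
  ((xx * y - x * xy) / (n * xx - x ^ 2), (x * y - n * xy) / (n * xx - x ^ 2))

lemma normalSol_spec {n x xx : ℝ} (hdet : n * xx - x ^ 2 ≠ 0) (y xy : ℝ) :
    n * (normalSol n x xx y xy).1 - x * (normalSol n x xx y xy).2 = y ∧
      xx * (normalSol n x xx y xy).2 - x * (normalSol n x xx y xy).1 = -xy := by
  simp only [normalSol]
  constructor <;> (rw [← mul_div_assoc, ← mul_div_assoc, ← sub_div, div_eq_iff hdet]; ring)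

lemma sqLoss_eq (h : List (Record N)) (e : Link N) (t : ℝ × ℝ) :
    sqLoss h e t = (h.map fun r => r.demand e ^ 2).sum + h.length * t.1 ^ 2
      + (h.map fun r => r.price e ^ 2).sum * t.2 ^ 2
      - 2 * t.1 * (h.map fun r => r.demand e).sum
      + 2 * t.2 * (h.map fun r => r.price e * r.demand e).sum
      - 2 * t.1 * t.2 * (h.map fun r => r.price e).sum := by
  unfold sqLoss
  induction h with
  | nil => simp
  | cons r h ih =>
    simp only [List.map_cons, List.sum_cons, List.length_cons, ih]
    push_cast
    ring

lemma sqLoss_sub_normalSol {h : List (Record N)} {e : Link N}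
    (hdet : (h.length : ℝ) * (h.map fun r => r.price e ^ 2).sum
      - (h.map fun r => r.price e).sum ^ 2 ≠ 0) (t : ℝ × ℝ) :
    let t' := normalSol h.length (h.map fun r => r.price e).sum
      (h.map fun r => r.price e ^ 2).sum (h.map fun r => r.demand e).sum
      (h.map fun r => r.price e * r.demand e).sum
    sqLoss h e t - sqLoss h e t' = h.length * (t.1 - t'.1) ^ 2
      - 2 * (h.map fun r => r.price e).sum * (t.1 - t'.1) * (t.2 - t'.2)
      + (h.map fun r => r.price e ^ 2).sum * (t.2 - t'.2) ^ 2 := by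
  intro t'
  rw [sqLoss_eq, sqLoss_eq]
  obtain ⟨h1, h2⟩ := normalSol_spec hdet (h.map fun r => r.demand e).sum
    (h.map fun r => r.price e * r.demand e).sum
  change _ * t'.1 - _ * t'.2 = _ at h1
  change _ * t'.2 - _ * t'.1 = _ at h2
  linear_combination (2 * (t.1 - t'.1)) * h1 + (2 * (t.2 - t'.2)) * h2

/-- A positive determinant makes the minimizer unique, so the arbitrary choice equals an explicit
rational formula. The formula yields measurability, the minimality yields the error bound. -/
lemma leastSquares_spec {h : List (Record N)} {e : Link N}
    (hdet : 0 < (h.length : ℝ) * (h.map fun r => r.price e ^ 2).sum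
      - (h.map fun r => r.price e).sum ^ 2) :
    leastSquares h e = normalSol h.length (h.map fun r => r.price e).sum
      (h.map fun r => r.price e ^ 2).sum (h.map fun r => r.demand e).sum
      (h.map fun r => r.price e * r.demand e).sum ∧
    ∀ t, sqLoss h e (leastSquares h e) ≤ sqLoss h e t := by
  set t' := normalSol h.length (h.map fun r => r.price e).sum
      (h.map fun r => r.price e ^ 2).sum (h.map fun r => r.demand e).sum
      (h.map fun r => r.price e * r.demand e).sum with ht'
  have hid := sqLoss_sub_normalSol hdet.ne'
  simp only [← ht'] at hid
  have hn : (0 : ℝ) < h.length := by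
    rcases List.eq_nil_or_concat h with rfl | ⟨l, a, rfl⟩
    · simp at hdet
    · simp; positivity
  -- Completing the square in the excess loss: the second coefficient is the determinant, so the
  -- excess vanishes only at `t'`.
  have hsq : ∀ t : ℝ × ℝ, h.length * (sqLoss h e t - sqLoss h e t')
      = (h.length * (t.1 - t'.1) - (h.map fun r => r.price e).sum * (t.2 - t'.2)) ^ 2
        + (h.length * (h.map fun r => r.price e ^ 2).sum
          - (h.map fun r => r.price e).sum ^ 2) * (t.2 - t'.2) ^ 2 := fun t => by
    rw [hid t]; ring
  have hmin : ∀ t, sqLoss h e t' ≤ sqLoss h e t := fun t => by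
    have h1 := hsq t
    have h2 : 0 ≤ h.length * (sqLoss h e t - sqLoss h e t') := by
      rw [h1]; positivity
    exact sub_nonneg.1 (nonneg_of_mul_nonneg_right h2 hn)
  have hspec : ∀ t, sqLoss h e (leastSquares h e) ≤ sqLoss h e t :=
    Classical.epsilon_spec (p := fun t => ∀ t', sqLoss h e t ≤ sqLoss h e t') ⟨t', hmin⟩
  refine ⟨?_, hspec⟩
  have h0 := hsq (leastSquares h e)
  rw [le_antisymm (hspec t') (hmin _), sub_self, mul_zero] at h0
  set a := leastSquares h e
  have h2 : (a.2 - t'.2) ^ 2 = 0 := by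
    have i1 := sq_nonneg (h.length * (a.1 - t'.1) - (h.map fun r => r.price e).sum * (a.2 - t'.2))
    have i2 := mul_nonneg hdet.le (sq_nonneg (a.2 - t'.2))
    have i3 := (mul_eq_zero.1 (le_antisymm (by linarith) i2))
    exact i3.resolve_left hdet.ne'
  have h3 : a.2 - t'.2 = 0 := by simpa using h2
  rw [h3] at h0
  simp only [mul_zero, sub_zero, ne_eq, OfNat.ofNat_ne_zero, not_false_eq_true, zero_pow,
    add_zero] at h0
  have h4 : a.1 - t'.1 = 0 := by
    have := (pow_eq_zero_iff two_ne_zero).1 h0.symm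
    exact (mul_eq_zero.1 this).resolve_left hn.ne'
  exact Prod.ext (sub_eq_zero.1 h4) (sub_eq_zero.1 h3)

/-- Clamping is nonexpansive and fixes `t`; hence the projection cannot increase the estimation
error. -/
lemma abs_clamp_sub_le {a lo hi t : ℝ} (h1 : lo ≤ t) (h2 : t ≤ hi) :
    |max (min a hi) lo - t| ≤ |a - t| := by
  have h3 : t = max (min t hi) lo := by rw [min_eq_left h2, max_eq_left h1]
  conv_lhs => rw [h3]
  exact (abs_max_sub_max_le_abs _ _ _).trans (abs_min_sub_min_le_max _ _ _ _ |>.trans (by simp))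

lemma project_mem (hα : M.αmin ≤ M.αmax) (hβ : M.βmin ≤ M.βmax) (t : ℝ × ℝ) :
    M.project t ∈ M.paramSet := by
  simp [project, paramSet, hα, hβ]

lemma measurable_project : Measurable M.project := by
  unfold project
  fun_prop

end Market

/-! ### Histories -/

section History

variable {N : ℕ} {S : Type*} (θ : Params N) (π : Policy N S) (s : S) (x : ℕ → Link N → ℝ)

/-- The demand on day `n + 1`. -/
noncomputable def demandAt (n : ℕ) (e : Link N) : ℝ :=
  demand θ e ((decision θ π s x n).price e) (x n e)

lemma history_eq (n : ℕ) : history θ π s x n = (List.range n).map fun k =>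
    { toDecision := decision θ π s x k, demand := demandAt θ π s x k } := by
  induction n with
  | zero => rfl
  | succ n ih =>
    rw [List.range_succ, List.map_append, ← ih]
    rfl

lemma length_history (n : ℕ) : (history θ π s x n).length = n := by
  simp [history_eq]

lemma dropLast_history (n : ℕ) : (history θ π s x (n + 1)).dropLast = history θ π s x n := by
  simp [history]

lemma sum_map_range (f : ℕ → ℝ) (n : ℕ) :
    ((List.range n).map f).sum = ∑ k ∈ Finset.range n, f k := by
  induction n with
  | zero => simp
  | succ n ih => simp [List.range_succ, Finset.sum_range_succ, ih]

lemma sum_map_history (f : Record N → ℝ) (n : ℕ) : ((history θ π s x n).map f).sum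
    = ∑ k ∈ Finset.range n,
      f { toDecision := decision θ π s x k, demand := demandAt θ π s x k } := by
  rw [history_eq, List.map_map, sum_map_range]
  rfl

end History

lemma sum_range_two_mul (f : ℕ → ℝ) (K : ℕ) :
    ∑ k ∈ Finset.range (2 * K), f k = ∑ j ∈ Finset.range K, (f (2 * j) + f (2 * j + 1)) := by
  induction K with
  | zero => simp
  | succ K ih =>
    rw [Finset.sum_range_succ, ← ih, mul_add_one, Finset.sum_range_succ, Finset.sum_range_succ]
    ring

/-- Two distinct bounded prices give information in every direction. -/
lemma sq_mul_le_of_price_pair {p δ δ₀ B Δ u₁ u₂ : ℝ} (hp : |p| ≤ B) (h0 : 0 ≤ δ₀) (hδ : δ₀ ≤ δ)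
    (hΔ : δ ≤ Δ) :
    δ₀ ^ 2 * (u₁ ^ 2 + u₂ ^ 2)
      ≤ (2 + 2 * Δ ^ 2 + 4 * B ^ 2) * ((u₁ - u₂ * p) ^ 2 + (u₁ - u₂ * (p - δ)) ^ 2) := by
  set a := u₁ - u₂ * p with ha
  set b := u₁ - u₂ * (p - δ) with hb
  have hδ0 : 0 ≤ δ := h0.trans hδ
  -- The two residuals determine both components: `u₂ * δ = b - a` and `δ * u₁ = δ * a + p * (u₂ *
  -- δ)`.
  have h1 : u₂ ^ 2 * δ ^ 2 ≤ 2 * (a ^ 2 + b ^ 2) := by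
    have : u₂ * δ = b - a := by rw [ha, hb]; ring
    rw [← mul_pow, this]
    linarith [sq_nonneg (a + b)]
  have hδΔ : δ ^ 2 ≤ Δ ^ 2 := by gcongr
  have hpB : p ^ 2 ≤ B ^ 2 := sq_le_sq.2 (hp.trans (le_abs_self B))
  have h2 : δ ^ 2 * u₁ ^ 2 ≤ 2 * (δ ^ 2 * a ^ 2) + 2 * (p ^ 2 * (u₂ ^ 2 * δ ^ 2)) := by
    have : δ * u₁ = δ * a + p * (u₂ * δ) := by rw [ha]; ring
    have h3 : (δ * u₁) ^ 2 = (δ * a + p * (u₂ * δ)) ^ 2 := by rw [this]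
    linarith [sq_nonneg (δ * a - p * (u₂ * δ))]
  have h3 : δ ^ 2 * a ^ 2 ≤ Δ ^ 2 * (a ^ 2 + b ^ 2) :=
    mul_le_mul hδΔ (by linarith [sq_nonneg b]) (sq_nonneg _) (sq_nonneg _)
  have h4 : p ^ 2 * (u₂ ^ 2 * δ ^ 2) ≤ B ^ 2 * (2 * (a ^ 2 + b ^ 2)) :=
    mul_le_mul hpB h1 (by positivity) (sq_nonneg _)
  have h5 : δ₀ ^ 2 * (u₁ ^ 2 + u₂ ^ 2) ≤ δ ^ 2 * (u₁ ^ 2 + u₂ ^ 2) := by gcongr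
  linarith

namespace Market

variable {N : ℕ} (M : Market N) (θ : Params N) (ρ η : ℝ)

/-! ### The dynamics of the NRPS policy -/

/-- The estimate that the NRPS policy uses on the days `2 * K + 1` and `2 * K + 2`. -/
noncomputable def estimateAt (s : Params N) (x : ℕ → Link N → ℝ) (K : ℕ) : Params N :=
  M.estimate s (history θ (M.nrps ρ η) s x (2 * K))

lemma decision_two_mul (s : Params N) (x : ℕ → Link N → ℝ) (K : ℕ) :
    decision θ (M.nrps ρ η) s x (2 * K) = M.optSol (M.estimateAt θ ρ η s x K) := by
  simp [decision, nrps, length_history, estimateAt]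

lemma decision_two_mul_add_one (s : Params N) (x : ℕ → Link N → ℝ) (K : ℕ) :
    decision θ (M.nrps ρ η) s x (2 * K + 1) =
      { price := fun e => (M.optSol (M.estimateAt θ ρ η s x K)).price e
          - ρ / (M.estimateAt θ ρ η s x K e).2 * ((2 * K + 2 : ℕ) : ℝ) ^ (-η)
        supply := fun e => (M.optSol (M.estimateAt θ ρ η s x K)).supply e
          + ρ * ((2 * K + 2 : ℕ) : ℝ) ^ (-η) } := by
  -- Index `2 * K + 1` is the even day `2 * K + 2`; dropping the last record leaves the history
  -- behind the previous decision.
  have h : ¬ Odd (2 * K + 1 + 1) := by simp [parity_simps]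
  rw [decision, nrps]
  simp only [length_history, dropLast_history]
  rw [if_neg h]
  rfl

variable {M θ} in
lemma estimateAt_mem_box (hθ : θ ∈ M.box) {s : Params N} (hs : s ∈ M.box)
    (x : ℕ → Link N → ℝ) (K : ℕ) : M.estimateAt θ ρ η s x K ∈ M.box := by
  intro e
  unfold estimateAt estimate
  split_ifs with h
  · exact hs e
  · have hb := mem_box_bounds hθ e
    exact M.project_mem (hb.1.1.trans hb.1.2) (hb.2.1.trans hb.2.2) _

variable {ρ η}

lemma rpow_neg_le_one (hη : 0 ≤ η) (K : ℕ) : ((2 * K + 2 : ℕ) : ℝ) ^ (-η) ≤ 1 := by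
  refine Real.rpow_le_one_of_one_le_of_nonpos ?_ (neg_nonpos.2 hη)
  exact_mod_cast (by omega : 1 ≤ 2 * K + 2)

variable {M θ} in
-- The perturbation lowers prices and raises all supplies by one common amount, so the cap,
-- nonnegativity and flow balance all survive.
lemma feasible_nrps (hθ : θ ∈ M.box) (hρ : 0 < ρ) {s : Params N} (hs : s ∈ M.box)
    (x : ℕ → Link N → ℝ) (n : ℕ) : M.Feasible (decision θ (M.nrps ρ η) s x n) := by
  rcases Nat.even_or_odd' n with ⟨K, rfl | rfl⟩
  · rw [decision_two_mul]
    exact (isOptimal_optSol (estimateAt_mem_box ρ η hθ hs x K)).1.1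
  · rw [decision_two_mul_add_one]
    have hb := estimateAt_mem_box ρ η hθ hs x K
    obtain ⟨h1, h2, h3⟩ := (isOptimal_optSol hb).1.1
    have hr : (0 : ℝ) ≤ ((2 * K + 2 : ℕ) : ℝ) ^ (-η) := by positivity
    refine ⟨fun e => ?_, fun e => ?_, FlowBalance.add_const h3 _⟩
    · have h4 := mul_nonneg (div_nonneg hρ.le (slope_pos hb e).le) hr
      linarith [h1 e]
    · have h4 := mul_nonneg hρ.le hr
      linarith [h2 e]

variable {M θ} in
lemma exists_nrps_bound (hθ : θ ∈ M.box) (hρ : 0 < ρ) (hη : 0 ≤ η) :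
    ∃ B, 0 ≤ B ∧ ∀ s ∈ M.box, ∀ x n e, |(decision θ (M.nrps ρ η) s x n).price e| ≤ B ∧
      |(decision θ (M.nrps ρ η) s x n).supply e| ≤ B := by
  obtain ⟨B, hB0, hB⟩ := M.exists_optSol_bound
  have hβ := M.βmin_pos
  refine ⟨B + ρ / M.βmin + ρ, by positivity, fun s hs x n e => ?_⟩
  have hq : 0 ≤ ρ / M.βmin := by positivity
  rcases Nat.even_or_odd' n with ⟨K, rfl | rfl⟩
  · rw [decision_two_mul]
    obtain ⟨h1, h2⟩ := hB _ (estimateAt_mem_box ρ η hθ hs x K) e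
    constructor <;> linarith
  · rw [decision_two_mul_add_one]
    have hb := estimateAt_mem_box ρ η hθ hs x K
    obtain ⟨h1, h2⟩ := hB _ hb e
    have hr : (0 : ℝ) ≤ ((2 * K + 2 : ℕ) : ℝ) ^ (-η) := by positivity
    have hr1 := rpow_neg_le_one hη K
    have h3 : ρ / (M.estimateAt θ ρ η s x K e).2 ≤ ρ / M.βmin :=
      div_le_div_of_nonneg_left hρ.le hβ (mem_box_bounds hb e).2.1
    have h4 : 0 ≤ ρ / (M.estimateAt θ ρ η s x K e).2 := div_nonneg hρ.le (slope_pos hb e).le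
    have h5 : ρ / (M.estimateAt θ ρ η s x K e).2 * ((2 * K + 2 : ℕ) : ℝ) ^ (-η)
        ≤ ρ / M.βmin := by nlinarith
    have h6 := mul_nonneg h4 hr
    have h7 : ρ * ((2 * K + 2 : ℕ) : ℝ) ^ (-η) ≤ ρ := by nlinarith
    have h8 := mul_nonneg hρ.le hr
    rw [abs_le] at h1 h2
    simp only [abs_le]
    refine ⟨⟨?_, ?_⟩, ?_, ?_⟩ <;> linarith [h1.1, h1.2, h2.1, h2.2]

/-! ### Information from price variation -/

/-- The order of the information in the prices of the first `2 * K` days. -/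
noncomputable def infoRate (η : ℝ) (K : ℕ) : ℝ := K * (((2 * K : ℕ) : ℝ) ^ (-η)) ^ 2

variable {M θ} in
-- Within each of the first `K` pairs of days the prices differ by at least `ρ / βmax * (2 * K) ^
-- (-η)`, whatever the estimate was, so each pair contributes the square of this in every direction,
-- up to a constant.
lemma exists_info_bound (hθ : θ ∈ M.box) (hρ : 0 < ρ) (hη : 0 ≤ η) :
    ∃ κ : Link N → ℝ, (∀ e, 0 < κ e) ∧ ∀ s ∈ M.box, ∀ x K e u₁ u₂,
      κ e * infoRate η K * (u₁ ^ 2 + u₂ ^ 2) ≤ ∑ k ∈ Finset.range (2 * K),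
        (u₁ - u₂ * (decision θ (M.nrps ρ η) s x k).price e) ^ 2 := by
  obtain ⟨B, hB0, hB⟩ := exists_nrps_bound hθ hρ hη
  have hβ := M.βmin_pos
  -- The value does not vary with the link, but positivity of `βmax` is only known from some `θ e`
  -- in the rectangle, hence the indexing by links.
  refine ⟨fun e => (ρ / M.βmax) ^ 2 / (2 + 2 * (ρ / M.βmin) ^ 2 + 4 * B ^ 2), fun e => ?_,
    fun s hs x K e u₁ u₂ => ?_⟩
  · have hb := mem_box_bounds hθ e
    have : 0 < M.βmax := by linarith
    positivity
  have hβ' : 0 < M.βmax := by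
    have hb := mem_box_bounds hθ e
    linarith
  set C := 2 + 2 * (ρ / M.βmin) ^ 2 + 4 * B ^ 2
  have hC : 0 < C := by positivity
  rw [sum_range_two_mul]
  set r := ((2 * K : ℕ) : ℝ) ^ (-η) with hr
  have hr0 : 0 ≤ r := by positivity
  have hpair : ∀ j ∈ Finset.range K, (ρ / M.βmax * r) ^ 2 * (u₁ ^ 2 + u₂ ^ 2) / C
      ≤ (u₁ - u₂ * (decision θ (M.nrps ρ η) s x (2 * j)).price e) ^ 2
        + (u₁ - u₂ * (decision θ (M.nrps ρ η) s x (2 * j + 1)).price e) ^ 2 := by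
    intro j hj
    rw [div_le_iff₀' hC]
    have hp := (hB s hs x (2 * j) e).1
    have hb := estimateAt_mem_box ρ η hθ hs x j
    rw [decision_two_mul_add_one]
    rw [decision_two_mul] at hp ⊢
    have hle : r ≤ ((2 * j + 2 : ℕ) : ℝ) ^ (-η) := by
      refine Real.rpow_le_rpow_of_nonpos (by positivity) ?_ (neg_nonpos.2 hη)
      have := Finset.mem_range.1 hj
      exact_mod_cast (by omega : 2 * j + 2 ≤ 2 * K)
    have hbe := (mem_box_bounds hb e).2
    have hpos := slope_pos hb e
    have hr1 := rpow_neg_le_one hη j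
    refine sq_mul_le_of_price_pair hp (by positivity) ?_ ?_
    · gcongr
      exact hbe.2
    · calc _ ≤ ρ / (M.estimateAt θ ρ η s x j e).2 * 1 := by gcongr
        _ ≤ _ := by rw [mul_one]; gcongr; exact hbe.1
  refine le_trans (le_of_eq ?_) (Finset.sum_le_sum hpair)
  rw [Finset.sum_const, Finset.card_range, nsmul_eq_mul, infoRate, ← hr]
  ring

lemma infoRate_pos {K : ℕ} (hK : 0 < K) : 0 < infoRate η K := by
  unfold infoRate
  have : (0 : ℝ) < K := by exact_mod_cast hK
  positivity

variable {M θ} in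
lemma nrps_det_pos (hθ : θ ∈ M.box) (hρ : 0 < ρ) (hη : 0 ≤ η) {s : Params N} (hs : s ∈ M.box)
    (x : ℕ → Link N → ℝ) {K : ℕ} (hK : 0 < K) (e : Link N) :
    0 < ((history θ (M.nrps ρ η) s x (2 * K)).length : ℝ)
      * ((history θ (M.nrps ρ η) s x (2 * K)).map fun r => r.price e ^ 2).sum
      - ((history θ (M.nrps ρ η) s x (2 * K)).map fun r => r.price e).sum ^ 2 := by
  obtain ⟨κ, hκ, hinfo⟩ := exists_info_bound hθ hρ hη
  rw [length_history, sum_map_history, sum_map_history]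
  set p : ℕ → ℝ := fun k => (decision θ (M.nrps ρ η) s x k).price e
  set n : ℝ := ((2 * K : ℕ) : ℝ) with hn
  have hn0 : 0 < n := by rw [hn]; exact_mod_cast (by omega : 0 < 2 * K)
  -- In the direction `(∑ p k, n)` the information is `n` times the determinant.
  have h1 := hinfo s hs x K e (∑ k ∈ Finset.range (2 * K), p k) n
  have h2 : ∑ k ∈ Finset.range (2 * K), (∑ k ∈ Finset.range (2 * K), p k - n * p k) ^ 2
      = n * (n * ∑ k ∈ Finset.range (2 * K), p k ^ 2 - (∑ k ∈ Finset.range (2 * K), p k) ^ 2) := by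
    generalize hT : ∑ k ∈ Finset.range (2 * K), p k = T
    have : ∀ k, (T - n * p k) ^ 2 = T ^ 2 - 2 * T * n * p k + n ^ 2 * p k ^ 2 := fun k => by ring
    simp_rw [this]
    rw [Finset.sum_add_distrib, Finset.sum_sub_distrib, ← Finset.mul_sum, ← Finset.mul_sum, hT]
    simp only [Finset.sum_const, Finset.card_range, nsmul_eq_mul, ← hn]
    ring
  have h3 : 0 < κ e * infoRate η K * ((∑ k ∈ Finset.range (2 * K), p k) ^ 2 + n ^ 2) :=
    mul_pos (mul_pos (hκ e) (infoRate_pos hK)) (by positivity)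
  have h4 := h3.trans_le (h1.trans_eq h2)
  exact (mul_pos_iff_of_pos_left hn0).1 h4

variable {M θ} in
/-- The estimation error in terms of the self-normalized noise. -/
lemma estimateAt_error_le (hθ : θ ∈ M.box) (hρ : 0 < ρ) (hη : 0 ≤ η) :
    ∃ κ : Link N → ℝ, (∀ e, 0 < κ e) ∧ ∀ s ∈ M.box, ∀ x K e, 0 < K → 1 ≤ κ e * infoRate η K →
      κ e * infoRate η K * (((M.estimateAt θ ρ η s x K e).1 - (θ e).1) ^ 2
          + ((M.estimateAt θ ρ η s x K e).2 - (θ e).2) ^ 2)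
        ≤ 8 * noiseNorm (fun k => -(decision θ (M.nrps ρ η) s x k).price e)
          (fun k => x k e) (2 * K) := by
  obtain ⟨κ, hκ, hinfo⟩ := exists_info_bound hθ hρ hη
  refine ⟨κ, hκ, fun s hs x K e hK h1 => ?_⟩
  set h := history θ (M.nrps ρ η) s x (2 * K) with hh
  have hne : h ≠ [] := by
    rw [← List.length_pos_iff_ne_nil, hh, length_history]
    omega
  have hest : M.estimateAt θ ρ η s x K e = M.project (leastSquares h e) := by
    rw [estimateAt, estimate, ← hh, if_neg hne]
  set t := leastSquares h e
  have hmin := (leastSquares_spec (nrps_det_pos hθ hρ hη hs x hK e)).2 (θ e)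
  rw [← hh] at hmin
  have hb := mem_box_bounds hθ e
  have c1 : ((M.estimateAt θ ρ η s x K e).1 - (θ e).1) ^ 2 ≤ (t.1 - (θ e).1) ^ 2 := by
    rw [hest]; exact sq_le_sq.2 (abs_clamp_sub_le hb.1.1 hb.1.2)
  have c2 : ((M.estimateAt θ ρ η s x K e).2 - (θ e).2) ^ 2 ≤ (t.2 - (θ e).2) ^ 2 := by
    rw [hest]; exact sq_le_sq.2 (abs_clamp_sub_le hb.2.1 hb.2.2)
  refine (mul_le_mul_of_nonneg_left (add_le_add c1 c2) (one_pos.le.trans h1)).trans ?_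
  refine mul_sq_le_noiseNorm h1 ?_ ?_
  · refine (hinfo s hs x K e _ _).trans_eq (Finset.sum_congr rfl fun k _ => by ring)
  · unfold sqLoss at hmin
    rw [hh, sum_map_history, sum_map_history] at hmin
    refine le_trans (le_of_eq ?_) (hmin.trans (le_of_eq ?_))
    · refine Finset.sum_congr rfl fun k _ => ?_
      simp only [demandAt, demand]
      ring
    · refine Finset.sum_congr rfl fun k _ => ?_
      simp only [demandAt, demand]
      ring

/-! ### Measurability -/

/-- Outside the box `optSol` is uncontrolled, so the composition passes through the subtype. -/
lemma measurable_comp_of_continuousOn_box {T : Type*} [MeasurableSpace T] {g : Params N → ℝ}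
    (hg : ContinuousOn g M.box) {f : T → Params N} (hf : Measurable f) (hfm : ∀ t, f t ∈ M.box) :
    Measurable fun t => g (f t) := by
  have h1 : Continuous (M.box.domRestrict g) := continuousOn_iff_continuous_domRestrict.1 hg
  exact h1.measurable.comp (hf.subtype_mk (h := hfm))

variable {M θ} in
lemma measurable_estimateAt (hθ : θ ∈ M.box) (hρ : 0 < ρ) (hη : 0 ≤ η) {T : Type*}
    [MeasurableSpace T] {s : T → Params N} (hs : Measurable s) (hsm : ∀ t, s t ∈ M.box)
    {x : ℕ → T → Link N → ℝ} {K : ℕ} (hx : ∀ k < 2 * K, Measurable (x k))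
    (hp : ∀ k < 2 * K, ∀ e, Measurable fun t =>
      (decision θ (M.nrps ρ η) (s t) (fun m => x m t) k).price e) :
    Measurable fun t => M.estimateAt θ ρ η (s t) (fun m => x m t) K := by
  rcases Nat.eq_zero_or_pos K with rfl | hK
  · simpa [estimateAt, estimate, history] using hs
  refine measurable_pi_lambda _ fun e => ?_
  have hest : ∀ t, M.estimateAt θ ρ η (s t) (fun m => x m t) K e = M.project
      (normalSol ((2 * K : ℕ) : ℝ)
        (∑ k ∈ Finset.range (2 * K),
          (decision θ (M.nrps ρ η) (s t) (fun m => x m t) k).price e)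
        (∑ k ∈ Finset.range (2 * K),
          (decision θ (M.nrps ρ η) (s t) (fun m => x m t) k).price e ^ 2)
        (∑ k ∈ Finset.range (2 * K), demandAt θ (M.nrps ρ η) (s t) (fun m => x m t) k e)
        (∑ k ∈ Finset.range (2 * K),
          (decision θ (M.nrps ρ η) (s t) (fun m => x m t) k).price e
            * demandAt θ (M.nrps ρ η) (s t) (fun m => x m t) k e)) := by
    intro t
    have hne : history θ (M.nrps ρ η) (s t) (fun m => x m t) (2 * K) ≠ [] := by
      rw [← List.length_pos_iff_ne_nil, length_history]
      omega
    rw [estimateAt, estimate, if_neg hne,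
      (leastSquares_spec (nrps_det_pos hθ hρ hη (hsm t) _ hK e)).1]
    simp only [length_history, sum_map_history]
  simp_rw [hest]
  refine M.measurable_project.comp ?_
  have hd : ∀ k ∈ Finset.range (2 * K),
      Measurable fun t => demandAt θ (M.nrps ρ η) (s t) (fun m => x m t) k e := by
    intro k hk
    have h1 := hp k (Finset.mem_range.1 hk) e
    have h2 : Measurable fun t => x k t e :=
      (measurable_pi_apply e).comp (hx k (Finset.mem_range.1 hk))
    unfold demandAt demand
    fun_prop
  have hp' : ∀ k ∈ Finset.range (2 * K),
      Measurable fun t => (decision θ (M.nrps ρ η) (s t) (fun m => x m t) k).price e :=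
    fun k hk => hp k (Finset.mem_range.1 hk) e
  have m1 := Finset.measurable_sum _ hp'
  have m2 := Finset.measurable_sum _ fun k hk => (hp' k hk).pow_const 2
  have m3 := Finset.measurable_sum _ hd
  have m4 := Finset.measurable_sum _ fun k hk => (hp' k hk).mul (hd k hk)
  unfold normalSol
  exact (((m2.mul m3).sub (m1.mul m4)).div ((m2.const_mul _).sub (m1.pow_const 2))).prodMk
    (((m1.mul m3).sub (m4.const_mul _)).div ((m2.const_mul _).sub (m1.pow_const 2)))

variable {M θ} in
-- Only the shocks before the day are assumed measurable. So `T` may carry the σ-algebra of the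
-- past, and the statement then says that the policy is nonanticipating.
lemma measurable_nrps (hθ : θ ∈ M.box) (hρ : 0 < ρ) (hη : 0 ≤ η) {T : Type*}
    [MeasurableSpace T] {s : T → Params N} (hs : Measurable s) (hsm : ∀ t, s t ∈ M.box)
    {x : ℕ → T → Link N → ℝ} (n : ℕ) (hx : ∀ k < n, Measurable (x k)) (e : Link N) :
    (Measurable fun t => (decision θ (M.nrps ρ η) (s t) (fun m => x m t) n).price e) ∧
      Measurable fun t => (decision θ (M.nrps ρ η) (s t) (fun m => x m t) n).supply e := by
  induction n using Nat.strong_induction_on generalizing e with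
  | _ n ih =>
    have hmem : ∀ K t, M.estimateAt θ ρ η (s t) (fun m => x m t) K ∈ M.box := fun K t =>
      estimateAt_mem_box ρ η hθ (hsm t) _ K
    have hE : ∀ K, 2 * K ≤ n →
        Measurable fun t => M.estimateAt θ ρ η (s t) (fun m => x m t) K := fun K hK =>
      measurable_estimateAt hθ hρ hη hs hsm (fun k hk => hx k (hk.trans_le hK)) fun k hk e =>
        (ih k (hk.trans_le hK) (fun j hj => hx j (hj.trans (hk.trans_le hK))) e).1
    rcases Nat.even_or_odd' n with ⟨K, rfl | rfl⟩
    · simp_rw [decision_two_mul]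
      exact ⟨M.measurable_comp_of_continuousOn_box (M.continuousOn_optSol_price e)
          (hE K le_rfl) (hmem K),
        M.measurable_comp_of_continuousOn_box (M.continuousOn_optSol_supply e)
          (hE K le_rfl) (hmem K)⟩
    · simp_rw [decision_two_mul_add_one]
      have hK := hE K (Nat.le_succ _)
      have h1 := M.measurable_comp_of_continuousOn_box (M.continuousOn_optSol_price e) hK (hmem K)
      have h2 := M.measurable_comp_of_continuousOn_box (M.continuousOn_optSol_supply e) hK (hmem K)
      have h3 : Measurable fun t => (M.estimateAt θ ρ η (s t) (fun m => x m t) K e).2 :=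
        measurable_snd.comp ((measurable_pi_apply e).comp hK)
      exact ⟨h1.sub ((h3.const_div ρ).mul_const _), h2.add_const _⟩

end Market

/-! ### Measurability and boundedness of the noise coefficients -/

/-- Predictability: the coefficient of shock `n` uses the regressors up to `n`, but only earlier
shocks. -/
lemma measurable_noiseCoeff {T : Type*} [MeasurableSpace T] {q z : ℕ → T → ℝ} {n : ℕ}
    (hq : ∀ k < n + 1, Measurable (q k)) (hz : ∀ k < n, Measurable (z k)) :
    Measurable fun t => noiseCoeff (fun k => q k t) (fun k => z k t) n := by
  have m1 : Measurable fun t => ∑ k ∈ Finset.range (n + 1), q k t :=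
    Finset.measurable_sum _ fun k hk => hq k (Finset.mem_range.1 hk)
  have m2 : Measurable fun t => ∑ k ∈ Finset.range (n + 1), q k t ^ 2 :=
    Finset.measurable_sum _ fun k hk => (hq k (Finset.mem_range.1 hk)).pow_const 2
  have m3 : Measurable fun t => ∑ k ∈ Finset.range n, z k t :=
    Finset.measurable_sum _ fun k hk => hz k (Finset.mem_range.1 hk)
  have m4 : Measurable fun t => ∑ k ∈ Finset.range n, q k t * z k t :=
    Finset.measurable_sum _ fun k hk =>
      (hq k ((Finset.mem_range.1 hk).trans n.lt_succ_self)).mul (hz k (Finset.mem_range.1 hk))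
  have m5 := hq n n.lt_succ_self
  unfold noiseCoeff gramDet gramSq gramCross noiseSum noiseCross
  fun_prop

lemma abs_sum_range_le {f : ℕ → ℝ} {B : ℝ} (hf : ∀ k, |f k| ≤ B) (n : ℕ) :
    |∑ k ∈ Finset.range n, f k| ≤ n * B := by
  refine (Finset.abs_sum_le_sum_abs _ _).trans ?_
  simpa using Finset.sum_le_card_nsmul (Finset.range n) (fun k => |f k|) B fun k _ => hf k

/-- Used only for integrability, so the growth of the bound in `n` is harmless. -/
lemma exists_noiseCoeff_bound (B B' : ℝ) (n : ℕ) : ∃ C, ∀ q z : ℕ → ℝ, (∀ k, |q k| ≤ B) →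
    (∀ k, |z k| ≤ B') → |noiseCoeff q z n| ≤ C := by
  refine ⟨2 * ((1 + (n + 1 : ℕ) * B ^ 2 + (n + 1 : ℕ) * B * B) * (n * B')
    + (gramOne (n + 1) * B + (n + 1 : ℕ) * B) * (n * (B * B'))), fun q z hq hz => ?_⟩
  have hB : 0 ≤ B := (abs_nonneg _).trans (hq 0)
  have hB' : 0 ≤ B' := (abs_nonneg _).trans (hz 0)
  have hg := gramOne_pos (n + 1)
  have e1 : |gramSq q (n + 1)| ≤ 1 + (n + 1 : ℕ) * B ^ 2 := by
    refine (abs_add_le _ _).trans ?_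
    rw [abs_one]
    gcongr
    refine abs_sum_range_le (fun k => ?_) (n + 1)
    rw [abs_pow]
    gcongr
    exact hq k
  have e2 : |gramCross q (n + 1)| ≤ (n + 1 : ℕ) * B := abs_sum_range_le hq (n + 1)
  have e3 : |noiseSum z n| ≤ n * B' := abs_sum_range_le hz n
  have e4 : |noiseCross q z n| ≤ n * (B * B') := by
    refine abs_sum_range_le (fun k => ?_) n
    rw [abs_mul]
    exact mul_le_mul (hq k) (hz k) (abs_nonneg _) hB
  have hD := one_le_gramDet q (n + 1)
  rw [noiseCoeff, abs_div, abs_of_pos (gramDet_pos q (n + 1))]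
  refine (div_le_self (abs_nonneg _) hD).trans ?_
  rw [abs_mul, abs_two]
  refine mul_le_mul_of_nonneg_left ((abs_add_le _ _).trans ?_) two_pos.le
  rw [abs_mul, abs_mul]
  have e5 : |gramSq q (n + 1) - gramCross q (n + 1) * q n|
      ≤ 1 + (n + 1 : ℕ) * B ^ 2 + (n + 1 : ℕ) * B * B := by
    refine (abs_sub _ _).trans (add_le_add e1 ?_)
    rw [abs_mul]
    exact mul_le_mul e2 (hq n) (abs_nonneg _) (by positivity)
  have e6 : |gramOne (n + 1) * q n - gramCross q (n + 1)|
      ≤ gramOne (n + 1) * B + (n + 1 : ℕ) * B := by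
    refine (abs_sub _ _).trans (add_le_add ?_ e2)
    rw [abs_mul, abs_of_pos hg]
    exact mul_le_mul_of_nonneg_left (hq n) hg.le
  gcongr

/-! ### Independence of the past -/

section Past

variable {N : ℕ} {Ω : Type*} [MeasurableSpace Ω] {P : Measure Ω} [IsProbabilityMeasure P]

/-- The hypotheses factor the joint law as `X ⊗ (Y ⊗ Z)`; reassociating gives the claim. It is
applied to the initial estimate, the earlier shocks and the current shock. -/
lemma indepFun_prodMk_left {α β γ : Type*} [MeasurableSpace α] [MeasurableSpace β]
    [MeasurableSpace γ] {X : Ω → α} {Y : Ω → β} {Z : Ω → γ} (hX : Measurable X)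
    (hY : Measurable Y) (hZ : Measurable Z) (h : IndepFun X (fun ω => (Y ω, Z ω)) P)
    (h' : IndepFun Y Z P) : IndepFun (fun ω => (X ω, Y ω)) Z P := by
  have : IsProbabilityMeasure (P.map X) := Measure.isProbabilityMeasure_map hX.aemeasurable
  have : IsProbabilityMeasure (P.map Y) := Measure.isProbabilityMeasure_map hY.aemeasurable
  have : IsProbabilityMeasure (P.map Z) := Measure.isProbabilityMeasure_map hZ.aemeasurable
  have h1 := (indepFun_iff_map_prod_eq_prod_map_map hX.aemeasurable
    (hY.prodMk hZ).aemeasurable).1 h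
  have h2 := (indepFun_iff_map_prod_eq_prod_map_map hY.aemeasurable hZ.aemeasurable).1 h'
  have h3 : IndepFun X Y P := h.comp measurable_id measurable_fst
  have h4 := (indepFun_iff_map_prod_eq_prod_map_map hX.aemeasurable hY.aemeasurable).1 h3
  rw [indepFun_iff_map_prod_eq_prod_map_map (hX.prodMk hY).aemeasurable hZ.aemeasurable, h4]
  rw [h2] at h1
  have h5 : P.map (fun ω => ((X ω, Y ω), Z ω))
      = (P.map fun ω => (X ω, Y ω, Z ω)).map MeasurableEquiv.prodAssoc.symm := by
    rw [Measure.map_map (MeasurableEquiv.measurable _) (hX.prodMk (hY.prodMk hZ))]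
    rfl
  rw [h5, h1, ← Measure.prodAssoc_prod, Measure.map_map (MeasurableEquiv.measurable _)
    (MeasurableEquiv.measurable _), MeasurableEquiv.symm_comp_self, Measure.map_id]

/-- The random data that are realized before day `n + 1`. -/
def pastData (ε : ℕ → Ω → Link N → ℝ) (θ₀ : Ω → Params N) (n : ℕ) (ω : Ω) :
    Params N × (Finset.range n → Link N → ℝ) :=
  (θ₀ ω, fun k => ε k ω)

variable {ε : ℕ → Ω → Link N → ℝ} {θ₀ : Ω → Params N}

lemma indepFun_pastData (hε_meas : ∀ n, Measurable (ε n)) (hε_indep : iIndepFun ε P)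
    (hθ₀_meas : Measurable θ₀) (hθ₀_indep : IndepFun θ₀ (fun ω n => ε n ω) P) (n : ℕ) :
    IndepFun (pastData ε θ₀ n) (ε n) P := by
  refine indepFun_prodMk_left hθ₀_meas (measurable_pi_lambda _ fun k => hε_meas k) (hε_meas n)
    ?_ ?_
  · have hφ : Measurable fun f : ℕ → Link N → ℝ => ((fun k : Finset.range n => f k), f n) := by
      fun_prop
    exact hθ₀_indep.comp measurable_id hφ
  · have h := hε_indep.indepFun_finset (Finset.range n) {n} (by simp) hε_meas
    exact h.comp measurable_id (measurable_pi_apply (⟨n, by simp⟩ : ({n} : Finset ℕ)))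

end Past

namespace Market

variable {N : ℕ} {M : Market N} {θ : Params N} {ρ η : ℝ}
  {Ω : Type*} {ε : ℕ → Ω → Link N → ℝ} {θ₀ : Ω → Params N}

lemma measurable_noiseCoeff_nrps (hθ : θ ∈ M.box) (hρ : 0 < ρ) (hη : 0 ≤ η)
    (hθ₀_mem : ∀ ω, θ₀ ω ∈ M.box) (n : ℕ) (e : Link N) :
    Measurable[MeasurableSpace.comap (pastData ε θ₀ n) inferInstance] fun ω => noiseCoeff
      (fun k => -(decision θ (M.nrps ρ η) (θ₀ ω) (fun m => ε m ω) k).price e)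
      (fun k => ε k ω e) n := by
  -- `Ω` carries the σ-algebra generated by the past, for which the earlier shocks are measurable.
  let _ : MeasurableSpace Ω := MeasurableSpace.comap (pastData ε θ₀ n) inferInstance
  have hpm : Measurable (pastData ε θ₀ n) := comap_measurable _
  have hθm : Measurable θ₀ := measurable_fst.comp hpm
  have hεm : ∀ k < n, Measurable (ε k) := fun k hk =>
    (measurable_pi_apply (⟨k, Finset.mem_range.2 hk⟩ : Finset.range n)).comp
      (measurable_snd.comp hpm)
  refine measurable_noiseCoeff (fun k hk => ?_) fun k hk => ?_
  · exact (measurable_nrps hθ hρ hη hθm hθ₀_mem k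
      (fun j hj => hεm j (hj.trans_le (Nat.lt_succ_iff.1 hk))) e).1.neg
  · exact (measurable_pi_apply e).comp (hεm k hk)

variable [MeasurableSpace Ω] {P : Measure Ω}

lemma integrable_shock (hε_meas : ∀ n, Measurable (ε n))
    (hε_law : ∀ n e, P.map (fun ω => ε n ω e) = M.F e) (n : ℕ) (e : Link N) :
    Integrable (fun ω => ε n ω e) P := by
  have hm : Measurable fun ω => ε n ω e := (measurable_pi_apply e).comp (hε_meas n)
  have h := M.integrable_id_shock e
  rw [← hε_law n e] at h
  exact (integrable_map_measure h.aestronglyMeasurable hm.aemeasurable).1 h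

lemma integral_shock (hε_meas : ∀ n, Measurable (ε n))
    (hε_law : ∀ n e, P.map (fun ω => ε n ω e) = M.F e) (n : ℕ) (e : Link N) :
    ∫ ω, ε n ω e ∂P = 0 := by
  have hm : Measurable fun ω => ε n ω e := (measurable_pi_apply e).comp (hε_meas n)
  have h := M.F_mean e
  rwa [← hε_law n e, integral_map hm.aemeasurable (by fun_prop)] at h

lemma ae_abs_shock_le (hε_meas : ∀ n, Measurable (ε n))
    (hε_law : ∀ n e, P.map (fun ω => ε n ω e) = M.F e) :
    ∀ᵐ ω ∂P, ∀ n e, |ε n ω e| ≤ max |M.εlo| |M.εhi| := by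
  rw [ae_all_iff]
  intro n
  rw [ae_all_iff]
  intro e
  have hm : Measurable fun ω => ε n ω e := (measurable_pi_apply e).comp (hε_meas n)
  have h := M.F_supp e
  rw [← hε_law n e] at h
  filter_upwards [ae_of_ae_map hm.aemeasurable h] with ω hω
  exact abs_le_max_abs_abs hω.1 hω.2

/-! ### The clairvoyant policy -/

variable [IsProbabilityMeasure P]

lemma integral_payoff (hε_meas : ∀ n, Measurable (ε n))
    (hε_law : ∀ n e, P.map (fun ω => ε n ω e) = M.F e) (n : ℕ) (y : Decision N) :
    ∫ ω, M.payoff θ y (ε n ω) ∂P = M.objective θ y := by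
  have hI : ∀ e, Integrable
      (fun ω => min (demand θ e (y.price e) (ε n ω e)) (y.supply e)) P := fun e => by
    have h1 : Integrable (fun ω => demand θ e (y.price e) (ε n ω e)) P :=
      (integrable_const _).add (integrable_shock hε_meas hε_law n e)
    exact h1.inf (integrable_const _)
  have hE : ∀ e, ∫ ω, min (demand θ e (y.price e) (ε n ω e)) (y.supply e) ∂P
      = ∫ s, min (demand θ e (y.price e) s) (y.supply e) ∂(M.F e) := fun e => by
    have hm : Measurable fun ω => ε n ω e := (measurable_pi_apply e).comp (hε_meas n)
    rw [← hε_law n e, integral_map hm.aemeasurable]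
    unfold demand
    fun_prop
  unfold payoff objective
  rw [integral_sub (integrable_finsetSum _ fun e _ => ((hI e).const_mul _).mul_const _)
    (integrable_const _), integral_finsetSum _ fun e _ => ((hI e).const_mul _).mul_const _]
  simp only [integral_mul_const, integral_const_mul, hE, integral_const, probReal_univ, one_smul]

/-- Mean-zero shocks make the two optimality predicates equal, so both choices are made from the
same predicate and uniqueness is not needed. -/
lemma clairvoyant_eq_optSol (hε_meas : ∀ n, Measurable (ε n))
    (hε_law : ∀ n e, P.map (fun ω => ε n ω e) = M.F e) (n : ℕ) :
    M.clairvoyant P ε θ n = M.optSol θ := by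
  have h1 : M.ClairvoyantFeasible P ε θ n = M.Balanced θ := by
    funext x
    unfold ClairvoyantFeasible Balanced demand
    have : ∀ e, ∫ ω, ((θ e).1 - (θ e).2 * x.price e + ε n ω e) ∂P
        = (θ e).1 - (θ e).2 * x.price e := fun e => by
      rw [integral_add (integrable_const _) (integrable_shock hε_meas hε_law n e),
        integral_shock hε_meas hε_law]
      simp
    simp_rw [this]
  have h2 : M.IsClairvoyant P ε θ n = M.IsOptimal θ := by
    funext x
    unfold IsClairvoyant IsOptimal
    simp_rw [h1, integral_payoff hε_meas hε_law]
  rw [clairvoyant, optSol, h2]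

/-! ### The expected estimation error -/

/-- Martingale difference: the coefficient is a function of the past, and the shock is independent
of the past with mean zero. -/
lemma integral_noiseCoeff_mul (hθ : θ ∈ M.box) (hρ : 0 < ρ) (hη : 0 ≤ η)
    (hε_meas : ∀ n, Measurable (ε n)) (hε_law : ∀ n e, P.map (fun ω => ε n ω e) = M.F e)
    (hε_indep : iIndepFun ε P) (hθ₀_meas : Measurable θ₀) (hθ₀_mem : ∀ ω, θ₀ ω ∈ M.box)
    (hθ₀_indep : IndepFun θ₀ (fun ω n => ε n ω) P) (n : ℕ) (e : Link N) :
    Integrable (fun ω => noiseCoeff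
        (fun k => -(decision θ (M.nrps ρ η) (θ₀ ω) (fun m => ε m ω) k).price e)
        (fun k => ε k ω e) n * ε n ω e) P ∧
      ∫ ω, noiseCoeff
        (fun k => -(decision θ (M.nrps ρ η) (θ₀ ω) (fun m => ε m ω) k).price e)
        (fun k => ε k ω e) n * ε n ω e ∂P = 0 := by
  set Z : Ω → ℝ := fun ω => noiseCoeff
    (fun k => -(decision θ (M.nrps ρ η) (θ₀ ω) (fun m => ε m ω) k).price e)
    (fun k => ε k ω e) n with hZdef
  have hpast : Measurable (pastData ε θ₀ n) :=
    hθ₀_meas.prodMk (measurable_pi_lambda _ fun k => hε_meas k)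
  have hZm : Measurable[MeasurableSpace.comap (pastData ε θ₀ n) inferInstance] Z :=
    measurable_noiseCoeff_nrps hθ hρ hη hθ₀_mem n e
  have hZ : Measurable Z := hZm.mono hpast.comap_le le_rfl
  have hεe : Measurable fun ω => ε n ω e := (measurable_pi_apply e).comp (hε_meas n)
  have hind : IndepFun Z (fun ω => ε n ω e) P := by
    have h1 := indepFun_pastData hε_meas hε_indep hθ₀_meas hθ₀_indep n
    have h2 : IndepFun (pastData ε θ₀ n) (fun ω => ε n ω e) P :=
      h1.comp measurable_id (measurable_pi_apply e)
    rw [IndepFun_iff_Indep] at h2 ⊢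
    exact indep_of_indep_of_le_left h2 hZm.comap_le
  obtain ⟨B, -, hB⟩ := exists_nrps_bound hθ hρ hη
  obtain ⟨C, hC⟩ := exists_noiseCoeff_bound B (max |M.εlo| |M.εhi|) n
  have hZb : ∀ᵐ ω ∂P, ‖Z ω‖ ≤ C := by
    filter_upwards [ae_abs_shock_le hε_meas hε_law] with ω hω
    exact hC _ _ (fun k => by rw [abs_neg]; exact (hB _ (hθ₀_mem ω) _ k e).1) fun k => hω k e
  refine ⟨(integrable_shock hε_meas hε_law n e).bdd_mul hZ.aestronglyMeasurable hZb, ?_⟩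
  rw [hind.integral_fun_mul_eq_mul_integral hZ.aestronglyMeasurable hεe.aestronglyMeasurable,
    integral_shock hε_meas hε_law, mul_zero]

/-- The squared distance of two parameter vectors. -/
noncomputable def sqDist (ϑ θ : Params N) : ℝ :=
  ∑ e, (((ϑ e).1 - (θ e).1) ^ 2 + ((ϑ e).2 - (θ e).2) ^ 2)

lemma exists_sqDist_bound (M : Market N) :
    ∃ C, ∀ ϑ ∈ M.box, ∀ θ ∈ M.box, ∀ e,
      ((ϑ e).1 - (θ e).1) ^ 2 + ((ϑ e).2 - (θ e).2) ^ 2 ≤ C := by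
  refine ⟨(M.αmax - M.αmin) ^ 2 + (M.βmax - M.βmin) ^ 2, fun ϑ hϑ θ hθ e => ?_⟩
  have h1 := mem_box_bounds hϑ e
  have h2 := mem_box_bounds hθ e
  refine add_le_add (sq_le_sq' ?_ ?_) (sq_le_sq' ?_ ?_) <;> linarith

lemma integrable_estimateAt_error (hθ : θ ∈ M.box) (hρ : 0 < ρ) (hη : 0 ≤ η)
    (hε_meas : ∀ n, Measurable (ε n)) (hθ₀_meas : Measurable θ₀) (hθ₀_mem : ∀ ω, θ₀ ω ∈ M.box)
    (K : ℕ) (e : Link N) :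
    Integrable (fun ω => ((M.estimateAt θ ρ η (θ₀ ω) (fun m => ε m ω) K e).1 - (θ e).1) ^ 2
      + ((M.estimateAt θ ρ η (θ₀ ω) (fun m => ε m ω) K e).2 - (θ e).2) ^ 2) P := by
  have h1 : Measurable fun ω => M.estimateAt θ ρ η (θ₀ ω) (fun m => ε m ω) K :=
    measurable_estimateAt hθ hρ hη hθ₀_meas hθ₀_mem (fun k _ => hε_meas k) fun k _ e =>
      (measurable_nrps hθ hρ hη hθ₀_meas hθ₀_mem k (fun j _ => hε_meas j) e).1
  have h2 : Measurable fun ω => M.estimateAt θ ρ η (θ₀ ω) (fun m => ε m ω) K e :=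
    (measurable_pi_apply e).comp h1
  obtain ⟨C, hC⟩ := exists_sqDist_bound M
  refine Integrable.of_bound (by fun_prop) C (Eventually.of_forall fun ω => ?_)
  rw [Real.norm_of_nonneg (by positivity)]
  exact hC _ (estimateAt_mem_box ρ η hθ (hθ₀_mem ω) _ K) _ hθ e

/-- Taking expectations removes the martingale from the self-normalized bound; what remains is the
logarithm of a determinant that is polynomial in `K`. -/
lemma integral_estimateAt_error_le (hθ : θ ∈ M.box) (hρ : 0 < ρ) (hη : 0 ≤ η)
    (hε_meas : ∀ n, Measurable (ε n)) (hε_law : ∀ n e, P.map (fun ω => ε n ω e) = M.F e)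
    (hε_indep : iIndepFun ε P) (hθ₀_meas : Measurable θ₀) (hθ₀_mem : ∀ ω, θ₀ ω ∈ M.box)
    (hθ₀_indep : IndepFun θ₀ (fun ω n => ε n ω) P) (e : Link N) :
    ∃ κ A B : ℝ, 0 < κ ∧ ∀ K, 0 < K → 1 ≤ κ * infoRate η K →
      κ * infoRate η K *
        ∫ ω, (((M.estimateAt θ ρ η (θ₀ ω) (fun m => ε m ω) K e).1 - (θ e).1) ^ 2
          + ((M.estimateAt θ ρ η (θ₀ ω) (fun m => ε m ω) K e).2 - (θ e).2) ^ 2) ∂P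
      ≤ A ^ 2 * Real.log ((1 + (2 * K : ℕ)) * (1 + (2 * K : ℕ) * B ^ 2)) := by
  obtain ⟨κ, hκ, herr⟩ := estimateAt_error_le hθ hρ hη
  obtain ⟨B, -, hB⟩ := exists_nrps_bound hθ hρ hη
  set Bε := max |M.εlo| |M.εhi|
  -- The square of `√8 * Bε` is the factor `8` of the error bound times the squared shock bound.
  refine ⟨κ e, Real.sqrt 8 * Bε, B, hκ e, fun K hK h1 => ?_⟩
  set Lg := Real.log ((1 + (2 * K : ℕ)) * (1 + (2 * K : ℕ) * B ^ 2)) with hLg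
  rw [mul_pow, Real.sq_sqrt (by norm_num), ← integral_const_mul]
  set Z : ℕ → Ω → ℝ := fun n ω => noiseCoeff
    (fun k => -(decision θ (M.nrps ρ η) (θ₀ ω) (fun m => ε m ω) k).price e)
    (fun k => ε k ω e) n * ε n ω e with hZ
  have hZI : ∀ n, Integrable (Z n) P ∧ ∫ ω, Z n ω ∂P = 0 := fun n =>
    integral_noiseCoeff_mul hθ hρ hη hε_meas hε_law hε_indep hθ₀_meas hθ₀_mem hθ₀_indep n e
  have hSI : Integrable (fun ω => ∑ k ∈ Finset.range (2 * K), Z k ω) P :=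
    integrable_finsetSum _ fun k _ => (hZI k).1
  calc _ ≤ ∫ ω, 8 * (∑ k ∈ Finset.range (2 * K), Z k ω + Bε ^ 2 * Lg) ∂P := by
        refine integral_mono_ae ((integrable_estimateAt_error hθ hρ hη hε_meas hθ₀_meas
          hθ₀_mem K e).const_mul _) ((hSI.add (integrable_const _)).const_mul _) ?_
        filter_upwards [ae_abs_shock_le hε_meas hε_law] with ω hω
        refine (herr (θ₀ ω) (hθ₀_mem ω) (fun m => ε m ω) K e hK h1).trans ?_
        refine mul_le_mul_of_nonneg_left ((noiseNorm_le (fun k => hω k e) _).trans ?_)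
          (by norm_num)
        have hdet := gramDet_le
          (q := fun k => -(decision θ (M.nrps ρ η) (θ₀ ω) (fun m => ε m ω) k).price e)
          (B := B) (fun k => by rw [abs_neg]; exact (hB _ (hθ₀_mem ω) _ k e).1) (2 * K)
        have := Real.log_le_log (gramDet_pos _ _) hdet
        gcongr
    _ = 8 * Bε ^ 2 * Lg := by
        rw [integral_const_mul, integral_add hSI (integrable_const _),
          integral_finsetSum _ fun k _ => (hZI k).1]
        simp only [(hZI _).2, Finset.sum_const_zero, integral_const, probReal_univ, one_smul]
        ring

/-! ### Growth of the information and consistency of the estimates -/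

lemma infoRate_eq {K : ℕ} (hK : 0 < K) :
    infoRate η K = (2 : ℝ) ^ (-(2 * η)) * (K : ℝ) ^ (1 - 2 * η) := by
  have hK' : (0 : ℝ) < K := by exact_mod_cast hK
  rw [infoRate, ← Real.rpow_natCast _ 2, ← Real.rpow_mul (by positivity)]
  push_cast
  rw [Real.mul_rpow (by norm_num) hK'.le]
  have e1 : -η * 2 = -(2 * η) := by ring
  have e2 : (K : ℝ) ^ (1 - 2 * η) = K * (K : ℝ) ^ (-(2 * η)) := by
    rw [sub_eq_add_neg, Real.rpow_add hK', Real.rpow_one]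
  rw [e1, e2]
  ring

/-- The exponent `1 - 2 * η` is positive exactly because `η < 1 / 2`: the perturbations must not
decay too fast. -/
lemma tendsto_infoRate (hη : η < 1 / 2) : Tendsto (fun K => infoRate η K) atTop atTop := by
  have h1 : Tendsto (fun K : ℕ => (K : ℝ) ^ (1 - 2 * η)) atTop atTop :=
    (tendsto_rpow_atTop (by linarith)).comp tendsto_natCast_atTop_atTop
  have h2 := h1.const_mul_atTop (r := (2 : ℝ) ^ (-(2 * η))) (by positivity)
  refine h2.congr' ?_
  filter_upwards [eventually_gt_atTop 0] with K hK
  rw [infoRate_eq hK]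

lemma tendsto_log_div_infoRate (hη : η < 1 / 2) (B : ℝ) :
    Tendsto (fun K : ℕ => Real.log ((1 + (2 * K : ℕ)) * (1 + (2 * K : ℕ) * B ^ 2))
      / infoRate η K) atTop (𝓝 0) := by
  have hI := tendsto_infoRate hη
  have hlog : Tendsto (fun K : ℕ => Real.log K / infoRate η K) atTop (𝓝 0) := by
    have h1 : Tendsto (fun x : ℝ => Real.log x / x ^ (1 - 2 * η)) atTop (𝓝 0) :=
      (isLittleO_log_rpow_atTop (by linarith)).tendsto_div_nhds_zero
    have h2 := (h1.comp tendsto_natCast_atTop_atTop).const_mul ((2 : ℝ) ^ (-(2 * η)))⁻¹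
    rw [mul_zero] at h2
    refine h2.congr' ?_
    filter_upwards [eventually_gt_atTop 0] with K hK
    rw [infoRate_eq hK]
    simp only [Function.comp]
    rw [div_mul_eq_div_div, mul_comm, ← div_eq_mul_inv, div_right_comm]
  have hup : Tendsto (fun K : ℕ => Real.log (9 * (1 + B ^ 2)) / infoRate η K
      + 2 * (Real.log K / infoRate η K)) atTop (𝓝 0) := by
    have := (tendsto_const_nhds (x := Real.log (9 * (1 + B ^ 2)))).div_atTop hI
    simpa using this.add (hlog.const_mul 2)
  refine squeeze_zero' ?_ ?_ hup
  · filter_upwards [eventually_gt_atTop 0] with K hK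
    refine div_nonneg (Real.log_nonneg ?_) (infoRate_pos hK).le
    have h1 : (1 : ℝ) ≤ 1 + (2 * K : ℕ) := by simp
    have h2 : (1 : ℝ) ≤ 1 + (2 * K : ℕ) * B ^ 2 := by
      have : (0 : ℝ) ≤ (2 * K : ℕ) * B ^ 2 := by positivity
      linarith
    nlinarith
  · filter_upwards [eventually_gt_atTop 0] with K hK
    have hK1 : (1 : ℝ) ≤ K := by exact_mod_cast hK
    have hle : (1 + ((2 * K : ℕ) : ℝ)) * (1 + (2 * K : ℕ) * B ^ 2)
        ≤ 9 * (1 + B ^ 2) * (K : ℝ) ^ 2 := by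
      push_cast
      have hb := sq_nonneg B
      have i1 : 1 + 2 * (K : ℝ) ≤ 3 * K := by linarith
      have i2 : 1 + 2 * (K : ℝ) * B ^ 2 ≤ 3 * K * (1 + B ^ 2) := by nlinarith
      calc _ ≤ (3 * K) * (3 * K * (1 + B ^ 2)) := by gcongr
        _ = _ := by ring
    have hl := Real.log_le_log (by positivity) hle
    rw [Real.log_mul (x := 9 * (1 + B ^ 2)) (by positivity) (by positivity), Real.log_pow] at hl
    rw [← mul_div_assoc, ← add_div]
    have := infoRate_pos (η := η) hK
    gcongr
    exact_mod_cast hl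

/-- The estimates converge to the true parameters in mean square. -/
lemma tendsto_integral_sqDist (hθ : θ ∈ M.box) (hρ : 0 < ρ) (hη : η ∈ Set.Ioo (0 : ℝ) (1 / 2))
    (hε_meas : ∀ n, Measurable (ε n)) (hε_law : ∀ n e, P.map (fun ω => ε n ω e) = M.F e)
    (hε_indep : iIndepFun ε P) (hθ₀_meas : Measurable θ₀) (hθ₀_mem : ∀ ω, θ₀ ω ∈ M.box)
    (hθ₀_indep : IndepFun θ₀ (fun ω n => ε n ω) P) :
    Tendsto (fun K => ∫ ω, sqDist (M.estimateAt θ ρ η (θ₀ ω) (fun m => ε m ω) K) θ ∂P)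
      atTop (𝓝 0) := by
  unfold sqDist
  simp_rw [integral_finsetSum _ fun e _ =>
    integrable_estimateAt_error hθ hρ hη.1.le hε_meas hθ₀_meas hθ₀_mem _ e]
  rw [← Finset.sum_const_zero (s := (Finset.univ : Finset (Link N)))]
  refine tendsto_finsetSum _ fun e _ => ?_
  obtain ⟨κ, A, B, hκ, h⟩ := integral_estimateAt_error_le hθ hρ hη.1.le hε_meas hε_law hε_indep
    hθ₀_meas hθ₀_mem hθ₀_indep e
  have h1 := (tendsto_log_div_infoRate hη.2 B).const_mul (A ^ 2 / κ)
  rw [mul_zero] at h1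
  have h2 : ∀ᶠ K in atTop, 1 ≤ κ * infoRate η K :=
    ((tendsto_infoRate hη.2).const_mul_atTop hκ).eventually_ge_atTop 1
  refine squeeze_zero' (Eventually.of_forall fun K => integral_nonneg fun ω => by positivity) ?_ h1
  filter_upwards [h2, eventually_gt_atTop 0] with K hK hK0
  have h3 := h K hK0 hK
  have h4 := infoRate_pos (η := η) hK0
  rw [div_mul_div_comm, le_div_iff₀ (mul_pos hκ h4), mul_comm]
  exact h3

end Market

namespace Market

variable {N : ℕ} {M : Market N} {θ : Params N} {ρ η : ℝ}

/-! ### Continuity of the payoff and of the optimal solution -/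

/-- The `ℓ¹`-distance of two decisions. -/
noncomputable def decisionDist (x y : Decision N) : ℝ :=
  ∑ e, (|x.price e - y.price e| + |x.supply e - y.supply e|)

lemma abs_min_mul_sub_le {a b d s s' p p' B D : ℝ} (hb : 0 ≤ b) (hp : |p| ≤ B)
    (hp' : |p'| ≤ B) (hs' : |s'| ≤ B) (ha : |a| ≤ D) (hd : |d| ≤ D) :
    |min (a - b * p + d) s * p - min (a - b * p' + d) s' * p'|
      ≤ ((b + 1) * B + (2 * D + (b + 1) * B)) * (|p - p'| + |s - s'|) := by
  have hB : 0 ≤ B := (abs_nonneg _).trans hp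
  have hD : 0 ≤ D := (abs_nonneg _).trans ha
  set m := min (a - b * p + d) s
  set m' := min (a - b * p' + d) s'
  have h1 : |m - m'| ≤ (b + 1) * (|p - p'| + |s - s'|) := by
    refine (abs_min_sub_min_le_max _ _ _ _).trans (max_le ?_ ?_)
    · have : a - b * p + d - (a - b * p' + d) = -(b * (p - p')) := by ring
      rw [this, abs_neg, abs_mul, abs_of_nonneg hb]
      nlinarith [abs_nonneg (p - p'), abs_nonneg (s - s'),
        mul_nonneg hb (abs_nonneg (s - s'))]
    · nlinarith [abs_nonneg (p - p'), abs_nonneg (s - s'),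
        mul_nonneg hb (abs_nonneg (s - s')), mul_nonneg hb (abs_nonneg (p - p'))]
  have h2 : |m'| ≤ 2 * D + (b + 1) * B := by
    refine abs_min_le_max_abs_abs.trans (max_le ?_ ?_)
    · have : |b * p'| ≤ b * B := by rw [abs_mul, abs_of_nonneg hb]; gcongr
      calc |a - b * p' + d| ≤ |a - b * p'| + |d| := abs_add_le _ _
        _ ≤ |a| + |b * p'| + |d| := by gcongr; exact abs_sub _ _
        _ ≤ _ := by linarith
    · nlinarith
  have h3 : m * p - m' * p' = (m - m') * p + m' * (p - p') := by ring
  rw [h3]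
  refine (abs_add_le _ _).trans ?_
  rw [abs_mul, abs_mul, add_mul]
  refine add_le_add ?_ ?_
  · calc _ ≤ (b + 1) * (|p - p'| + |s - s'|) * B := by gcongr
      _ = _ := by ring
  · gcongr
    linarith [abs_nonneg (s - s')]

lemma exists_payoff_lipschitz (hθ : θ ∈ M.box) (B D : ℝ) : ∃ L, 0 ≤ L ∧ ∀ x y : Decision N,
    ∀ s : Link N → ℝ, (∀ e, |x.price e| ≤ B ∧ |x.supply e| ≤ B) →
    (∀ e, |y.price e| ≤ B ∧ |y.supply e| ≤ B) → (∀ e, |s e| ≤ D) →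
    |M.payoff θ x s - M.payoff θ y s| ≤ L * decisionDist x y := by
  set G : Link N → ℝ := fun e =>
    M.ξ e * ((((θ e).2 + 1) * B + (2 * max |(θ e).1| D + ((θ e).2 + 1) * B)) + M.c)
  refine ⟨∑ e, |G e|, by positivity, fun x y s hx hy hs => ?_⟩
  have h1 : M.payoff θ x s - M.payoff θ y s
      = ∑ e, M.ξ e * ((min (demand θ e (x.price e) (s e)) (x.supply e) * x.price e
        - min (demand θ e (y.price e) (s e)) (y.supply e) * y.price e)
        - (x.supply e - y.supply e) * M.c) := by
    unfold payoff
    rw [← Finset.sum_sub_distrib, ← Finset.sum_sub_distrib, ← Finset.sum_sub_distrib]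
    exact Finset.sum_congr rfl fun e _ => by ring
  rw [h1, decisionDist, Finset.mul_sum]
  refine (Finset.abs_sum_le_sum_abs _ _).trans (Finset.sum_le_sum fun e _ => ?_)
  have h2 := abs_min_mul_sub_le (s := x.supply e) (slope_pos hθ e).le (hx e).1 (hy e).1 (hy e).2
    (le_max_left |(θ e).1| D) ((hs e).trans (le_max_right _ _))
  have h3 : |(x.supply e - y.supply e) * M.c|
      ≤ M.c * (|x.price e - y.price e| + |x.supply e - y.supply e|) := by
    have := M.c_pos
    rw [abs_mul, abs_of_pos this, mul_comm]
    gcongr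
    linarith [abs_nonneg (x.price e - y.price e)]
  have h4 : |G e| ≤ ∑ f, |G f| :=
    Finset.single_le_sum (f := fun f => |G f|) (fun f _ => abs_nonneg _) (Finset.mem_univ e)
  rw [abs_mul, abs_of_pos (M.ξ_pos e)]
  calc _ ≤ M.ξ e * (((((θ e).2 + 1) * B + (2 * max |(θ e).1| D + ((θ e).2 + 1) * B))
          * (|x.price e - y.price e| + |x.supply e - y.supply e|))
          + M.c * (|x.price e - y.price e| + |x.supply e - y.supply e|)) :=
        mul_le_mul_of_nonneg_left ((abs_sub _ _).trans (add_le_add h2 h3)) (M.ξ_pos e).le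
    _ = G e * (|x.price e - y.price e| + |x.supply e - y.supply e|) := by ring
    _ ≤ _ := mul_le_mul_of_nonneg_right ((le_abs_self _).trans h4) (by positivity)

lemma norm_lt_of_sqDist_lt {ϑ : Params N} {r : ℝ} (hr : 0 < r) (h : sqDist ϑ θ < r ^ 2) :
    ‖ϑ - θ‖ < r := by
  rw [pi_norm_lt_iff hr]
  intro e
  have h1 : ((ϑ e).1 - (θ e).1) ^ 2 + ((ϑ e).2 - (θ e).2) ^ 2 < r ^ 2 :=
    (Finset.single_le_sum
      (f := fun e => ((ϑ e).1 - (θ e).1) ^ 2 + ((ϑ e).2 - (θ e).2) ^ 2)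
      (fun e _ => by positivity) (Finset.mem_univ e)).trans_lt h
  rw [Prod.norm_def]
  refine max_lt ?_ ?_
  · exact abs_lt_of_sq_lt_sq (by
      simp only [Pi.sub_apply, Prod.fst_sub]; linarith [sq_nonneg ((ϑ e).2 - (θ e).2)]) hr.le
  · exact abs_lt_of_sq_lt_sq (by
      simp only [Pi.sub_apply, Prod.snd_sub]; linarith [sq_nonneg ((ϑ e).1 - (θ e).1)]) hr.le

/-- Near `θ` continuity gives `δ`. At squared distance at least `r ^ 2` the uniform bound `A` is at
most `A / r ^ 2 * sqDist`, as in Markov's inequality. Mean-square consistency thus suffices without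
a modulus of continuity. -/
lemma exists_optSol_dist_le (hθ : θ ∈ M.box) {δ : ℝ} (hδ : 0 < δ) :
    ∃ C, 0 ≤ C ∧ ∀ ϑ ∈ M.box,
      decisionDist (M.optSol θ) (M.optSol ϑ) ≤ δ + C * sqDist ϑ θ := by
  obtain ⟨B, hB0, hB⟩ := M.exists_optSol_bound
  have hcont : ContinuousOn (fun ϑ => decisionDist (M.optSol θ) (M.optSol ϑ)) M.box := by
    unfold decisionDist
    exact continuousOn_finsetSum _ fun e _ =>
      ((continuousOn_const.sub (M.continuousOn_optSol_price e)).abs).add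
        ((continuousOn_const.sub (M.continuousOn_optSol_supply e)).abs)
  have h0 : decisionDist (M.optSol θ) (M.optSol θ) = 0 := by simp [decisionDist]
  obtain ⟨r, hr, hball⟩ := Metric.continuousOn_iff.1 hcont θ hθ δ hδ
  set A : ℝ := ∑ _e : Link N, 4 * B with hA
  have hA0 : 0 ≤ A := by positivity
  refine ⟨A / r ^ 2, by positivity, fun ϑ hϑ => ?_⟩
  have hs : 0 ≤ sqDist ϑ θ := Finset.sum_nonneg fun e _ => by positivity
  by_cases h : sqDist ϑ θ < r ^ 2
  · have h1 := hball ϑ hϑ (by rw [dist_eq_norm]; exact norm_lt_of_sqDist_lt hr h)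
    rw [h0, Real.dist_eq, sub_zero] at h1
    have h2 := (le_abs_self _).trans h1.le
    have : 0 ≤ A / r ^ 2 * sqDist ϑ θ := by positivity
    linarith
  · have h1 : decisionDist (M.optSol θ) (M.optSol ϑ) ≤ A := by
      refine Finset.sum_le_sum fun e _ => ?_
      have i1 := hB θ hθ e
      have i2 := hB ϑ hϑ e
      have i3 := abs_sub ((M.optSol θ).price e) ((M.optSol ϑ).price e)
      have i4 := abs_sub ((M.optSol θ).supply e) ((M.optSol ϑ).supply e)
      linarith [i1.1, i1.2, i2.1, i2.2]
    have h2 : A ≤ A / r ^ 2 * sqDist ϑ θ := by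
      rw [div_mul_eq_mul_div, le_div_iff₀ (by positivity)]
      exact mul_le_mul_of_nonneg_left (not_lt.1 h) hA0
    linarith

lemma decisionDist_triangle (x y z : Decision N) :
    decisionDist x z ≤ decisionDist x y + decisionDist y z := by
  unfold decisionDist
  rw [← Finset.sum_add_distrib]
  refine Finset.sum_le_sum fun e _ => ?_
  have h1 := abs_sub_le (x.price e) (y.price e) (z.price e)
  have h2 := abs_sub_le (x.supply e) (y.supply e) (z.supply e)
  linarith

/-- The price perturbations of the NRPS policy are uniformly small. -/
lemma exists_nrps_dist_optSol (hθ : θ ∈ M.box) (hρ : 0 < ρ) :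
    ∃ A, 0 ≤ A ∧ ∀ s ∈ M.box, ∀ x n,
      decisionDist (M.optSol (M.estimateAt θ ρ η s x (n / 2))) (decision θ (M.nrps ρ η) s x n)
        ≤ A * ((2 * (n / 2) + 2 : ℕ) : ℝ) ^ (-η) := by
  have hβ := M.βmin_pos
  refine ⟨∑ _e : Link N, (ρ / M.βmin + ρ), by positivity, fun s hs x n => ?_⟩
  rcases Nat.even_or_odd' n with ⟨K, rfl | rfl⟩
  · rw [decision_two_mul, Nat.mul_div_cancel_left _ two_pos]
    have : decisionDist (M.optSol (M.estimateAt θ ρ η s x K))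
      (M.optSol (M.estimateAt θ ρ η s x K)) = 0 := by simp [decisionDist]
    rw [this]
    positivity
  · have hK : (2 * K + 1) / 2 = K := by omega
    rw [decision_two_mul_add_one, hK, decisionDist, Finset.sum_mul]
    have hb := estimateAt_mem_box ρ η hθ hs x K
    refine Finset.sum_le_sum fun e _ => ?_
    have hbe := (mem_box_bounds hb e).2.1
    have hpos := slope_pos hb e
    simp only [sub_sub_cancel, sub_add_cancel_left, abs_neg]
    rw [abs_of_nonneg (by positivity), abs_of_nonneg (by positivity), add_mul]
    gcongr

/-! ### The regret -/

variable {Ω : Type*} [MeasurableSpace Ω] {P : Measure Ω} [IsProbabilityMeasure P]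
  {ε : ℕ → Ω → Link N → ℝ} {θ₀ : Ω → Params N}

/-- The expected absolute payoff loss on a day vanishes, and the payoff loss is integrable. -/
lemma dailyGap_spec (hθ : θ ∈ M.box) (hρ : 0 < ρ) (hη : η ∈ Set.Ioo (0 : ℝ) (1 / 2))
    (hε_meas : ∀ n, Measurable (ε n)) (hε_law : ∀ n e, P.map (fun ω => ε n ω e) = M.F e)
    (hε_indep : iIndepFun ε P) (hθ₀_meas : Measurable θ₀) (hθ₀_mem : ∀ ω, θ₀ ω ∈ M.box)
    (hθ₀_indep : IndepFun θ₀ (fun ω n => ε n ω) P) :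
    (∀ n, Integrable (fun ω => M.payoff θ (M.optSol θ) (ε n ω)
      - M.payoff θ (decision θ (M.nrps ρ η) (θ₀ ω) (fun m => ε m ω) n) (ε n ω)) P) ∧
    Tendsto (fun n => ∫ ω, (M.payoff θ (M.optSol θ) (ε n ω)
      - M.payoff θ (decision θ (M.nrps ρ η) (θ₀ ω) (fun m => ε m ω) n) (ε n ω)) ∂P)
      atTop (𝓝 0) := by
  obtain ⟨B₁, -, hB₁⟩ := M.exists_optSol_bound
  obtain ⟨B₂, -, hB₂⟩ := exists_nrps_bound hθ hρ hη.1.le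
  set B := max B₁ B₂
  have hopt : ∀ ϑ ∈ M.box, ∀ e, |(M.optSol ϑ).price e| ≤ B ∧ |(M.optSol ϑ).supply e| ≤ B :=
    fun ϑ hϑ e => ⟨(hB₁ ϑ hϑ e).2.trans (le_max_left _ _), (hB₁ ϑ hϑ e).1.trans (le_max_left _ _)⟩
  have hdec : ∀ s ∈ M.box, ∀ x n e, |(decision θ (M.nrps ρ η) s x n).price e| ≤ B ∧
      |(decision θ (M.nrps ρ η) s x n).supply e| ≤ B := fun s hs x n e =>
    ⟨(hB₂ s hs x n e).1.trans (le_max_right _ _), (hB₂ s hs x n e).2.trans (le_max_right _ _)⟩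
  obtain ⟨L, hL0, hL⟩ := exists_payoff_lipschitz hθ B (max |M.εlo| |M.εhi|)
  have hae := ae_abs_shock_le hε_meas hε_law
  set gap : ℕ → Ω → ℝ := fun n ω => M.payoff θ (M.optSol θ) (ε n ω)
      - M.payoff θ (decision θ (M.nrps ρ η) (θ₀ ω) (fun m => ε m ω) n) (ε n ω)
  have hgap : ∀ n, ∀ᵐ ω ∂P, |gap n ω| ≤ L * decisionDist (M.optSol θ)
      (decision θ (M.nrps ρ η) (θ₀ ω) (fun m => ε m ω) n) := by
    intro n
    filter_upwards [hae] with ω hω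
    exact hL _ _ _ (hopt θ hθ) (hdec _ (hθ₀_mem ω) _ n) (hω n)
  have hmeas : ∀ n, Measurable (gap n) := by
    intro n
    have h1 : ∀ e, Measurable fun ω => ε n ω e := fun e =>
      (measurable_pi_apply e).comp (hε_meas n)
    have h2 := fun e => measurable_nrps hθ hρ hη.1.le hθ₀_meas hθ₀_mem n
      (fun k _ => hε_meas k) e
    have h3 := fun e => (h2 e).1
    have h4 := fun e => (h2 e).2
    simp only [gap, payoff, demand]
    fun_prop
  have hint : ∀ n, Integrable (gap n) P := by
    intro n
    refine Integrable.of_bound (hmeas n).aestronglyMeasurable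
      (L * ∑ _e : Link N, 4 * B) ?_
    filter_upwards [hgap n] with ω hω
    refine hω.trans (mul_le_mul_of_nonneg_left (Finset.sum_le_sum fun e _ => ?_) hL0)
    have i1 := hopt θ hθ e
    have i2 := hdec _ (hθ₀_mem ω) (fun m => ε m ω) n e
    have i3 := abs_sub ((M.optSol θ).price e)
      ((decision θ (M.nrps ρ η) (θ₀ ω) (fun m => ε m ω) n).price e)
    have i4 := abs_sub ((M.optSol θ).supply e)
      ((decision θ (M.nrps ρ η) (θ₀ ω) (fun m => ε m ω) n).supply e)
    linarith [i1.1, i1.2, i2.1, i2.2]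
  refine ⟨hint, ?_⟩
  obtain ⟨A, hA0, hA⟩ := exists_nrps_dist_optSol (η := η) hθ hρ
  set R : ℕ → ℝ := fun K => ∫ ω, sqDist (M.estimateAt θ ρ η (θ₀ ω) (fun m => ε m ω) K) θ ∂P
  have hR : Tendsto R atTop (𝓝 0) :=
    tendsto_integral_sqDist hθ hρ hη hε_meas hε_law hε_indep hθ₀_meas hθ₀_mem hθ₀_indep
  have hRI : ∀ K, Integrable
      (fun ω => sqDist (M.estimateAt θ ρ η (θ₀ ω) (fun m => ε m ω) K) θ) P := fun K =>
    integrable_finsetSum _ fun e _ =>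
      integrable_estimateAt_error hθ hρ hη.1.le hε_meas hθ₀_meas hθ₀_mem K e
  have hhalf : Tendsto (fun n : ℕ => n / 2) atTop atTop :=
    Nat.tendsto_div_const_atTop (by norm_num)
  have hpow : Tendsto (fun n : ℕ => ((2 * (n / 2) + 2 : ℕ) : ℝ) ^ (-η)) atTop (𝓝 0) := by
    refine (tendsto_rpow_neg_atTop hη.1).comp (tendsto_natCast_atTop_atTop.comp ?_)
    refine tendsto_atTop_mono (fun n => ?_) tendsto_id
    simp only [id]
    omega
  rw [Metric.tendsto_atTop']
  intro τ hτ
  -- Makes the limiting bound `L * δ` smaller than `τ`, also when `L = 0`.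
  set δ := τ / (2 * (L + 1)) with hδdef
  have hδ : 0 < δ := by positivity
  obtain ⟨C, hC0, hC⟩ := exists_optSol_dist_le hθ hδ
  have hlim : Tendsto (fun n : ℕ => L * (δ + C * R (n / 2)
      + A * ((2 * (n / 2) + 2 : ℕ) : ℝ) ^ (-η))) atTop (𝓝 (L * (δ + C * 0 + A * 0))) :=
    ((tendsto_const_nhds.add ((hR.comp hhalf).const_mul C)).add (hpow.const_mul A)).const_mul L
  have hlt : L * (δ + C * 0 + A * 0) < τ := by
    have : δ * (2 * (L + 1)) = τ := by rw [hδdef]; field_simp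
    nlinarith
  obtain ⟨n₀, hn₀⟩ := eventually_atTop.1 (hlim.eventually (gt_mem_nhds hlt))
  refine ⟨n₀, fun n hn => ?_⟩
  rw [Real.dist_eq, sub_zero]
  refine lt_of_le_of_lt ?_ (hn₀ n hn.le)
  calc |∫ ω, gap n ω ∂P| ≤ ∫ ω, |gap n ω| ∂P := abs_integral_le_integral_abs
    _ ≤ ∫ ω, L * (δ + C * sqDist (M.estimateAt θ ρ η (θ₀ ω) (fun m => ε m ω) (n / 2)) θ
        + A * ((2 * (n / 2) + 2 : ℕ) : ℝ) ^ (-η)) ∂P := by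
      refine integral_mono_ae (hint n).abs (((integrable_const _).add
        ((hRI _).const_mul _)).add (integrable_const _) |>.const_mul _) ?_
      filter_upwards [hgap n] with ω hω
      refine hω.trans (mul_le_mul_of_nonneg_left ?_ hL0)
      refine (decisionDist_triangle _ (M.optSol (M.estimateAt θ ρ η (θ₀ ω) (fun m => ε m ω)
        (n / 2))) _).trans (add_le_add ?_ (hA _ (hθ₀_mem ω) _ n))
      exact hC _ (estimateAt_mem_box ρ η hθ (hθ₀_mem ω) _ _)
    _ = L * (δ + C * R (n / 2) + A * ((2 * (n / 2) + 2 : ℕ) : ℝ) ^ (-η)) := by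
      have hI : Integrable (fun ω => δ + C * sqDist
          (M.estimateAt θ ρ η (θ₀ ω) (fun m => ε m ω) (n / 2)) θ) P :=
        (integrable_const _).add ((hRI _).const_mul _)
      rw [integral_const_mul, integral_add hI (integrable_const _),
        integral_add (integrable_const _) ((hRI _).const_mul _), integral_const_mul]
      simp [R]

end Market

end VehicleService

theorem corollary1 {N : ℕ} (M : VehicleService.Market N)
    -- the true demand parameters, unknown to the provider
    (θ : VehicleService.Params N) (hθ : ∀ e, θ e ∈ M.paramSet)
    -- the control parameters
    (ρ η : ℝ) (hρ : 0 < ρ) (hη : η ∈ Set.Ioo (0 : ℝ) (1 / 2))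
    {Ω : Type*} [MeasurableSpace Ω] (P : Measure Ω) [IsProbabilityMeasure P]
    -- the demand shocks
    (ε : ℕ → Ω → VehicleService.Link N → ℝ) (hε_meas : ∀ n, Measurable (ε n))
    (hε_law : ∀ n e, P.map (fun ω => ε n ω e) = M.F e)
    (hε_indep : iIndepFun ε P)
    -- the random initial estimate
    (θ₀ : Ω → VehicleService.Params N) (hθ₀_meas : Measurable θ₀)
    (hθ₀_mem : ∀ ω e, θ₀ ω e ∈ M.paramSet)
    (hθ₀_indep : IndepFun θ₀ (fun ω n => ε n ω) P) :
    M.IsNoRegret P ε θ (M.nrps ρ η) θ₀ := by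
  obtain ⟨hint, hlim⟩ := VehicleService.Market.dailyGap_spec (M := M) hθ hρ hη hε_meas hε_law
    hε_indep hθ₀_meas hθ₀_mem hθ₀_indep
  refine ⟨fun ω n => VehicleService.Market.feasible_nrps hθ hρ (hθ₀_mem ω) _ n,
    fun D => ?_, ?_⟩
  · unfold VehicleService.Market.avgGap
    simp_rw [VehicleService.Market.clairvoyant_eq_optSol hε_meas hε_law]
    exact (integrable_finsetSum _ fun n _ => hint n).const_mul _
  -- Exchanging expectation and finite sum exhibits the regret as the Cesàro mean of the expected
  -- daily gaps.
  · refine hlim.cesaro.congr fun D => ?_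
    unfold VehicleService.Market.regret VehicleService.Market.avgGap
    simp_rw [VehicleService.Market.clairvoyant_eq_optSol hε_meas hε_law]
    rw [integral_const_mul, integral_finsetSum _ fun n _ => hint n, one_div]
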